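/- Let $a<b$ be real numbers and let $f:(a,b)\to\mathbb{R}$ be locally integrable. For a nonempty open interval $I$ compactly contained in $(a,b)$, put $$(f)_I=\frac1{|I|}\int_I f\,dx,\qquad \operatorname{osc}(f,I)=\frac1{|I|}\int_I|f-(f)_I|\,dx,$$ $$|Df|(I)=\sup\Big\{\int_I f\varphi'\,dx:\ \varphi\in C_c^\infty(I),\ \|\varphi\|_{L^\infty(I)}\le 1\Big\}\in[0,\infty].$$ Suppose that $\operatorname{osc}(f,I)=\frac14|Df|(I)$ for every nonempty open interval $I$ compactly contained in $(a,b)$. Then $f$ is affine: there are $\alpha,\beta\in\mathbb{R}$ such that $f(x)=\alpha x+\beta$ for almost every $x\in(a,b)$. -/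

import Mathlib

open scoped ContDiff ENNReal

/-- The mean oscillation `osc(f, I) = ⨍_I |f - (f)_I|`, where `(f)_I = ⨍_I f`. -/
noncomputable def osc (f : ℝ → ℝ) (I : Set ℝ) : ℝ :=
  ⨍ x in I, |f x - ⨍ y in I, f y|

/-- The test functions admitted in the total variation on an open set `I`: functions in
`C_c^∞(I)`, extended by zero to the line, that are bounded by one in absolute value. -/
structure IsUnitTestFunction (I : Set ℝ) (φ : ℝ → ℝ) : Prop where
  contDiff : ContDiff ℝ ∞ φ
  hasCompactSupport : HasCompactSupport φ
  tsupport_subset : tsupport φ ⊆ I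
  abs_le_one : ∀ x, |φ x| ≤ 1

/-- The total variation `|Df|(I) ∈ [0, ∞]` of the distributional derivative of `f` on an open
set `I`, that is, the supremum of `∫_I f φ'` over the test functions `φ ∈ C_c^∞(I)` with
`‖φ‖_∞ ≤ 1`. Since `φ = 0` is admitted, truncating the integrals at zero does not change the
supremum. -/
noncomputable def totalVariation (f : ℝ → ℝ) (I : Set ℝ) : ℝ≥0∞ :=
  ⨆ (φ : ℝ → ℝ) (_ : IsUnitTestFunction I φ), ENNReal.ofReal (∫ x in I, f x * deriv φ x)

/-!
Write `W(c, d)` for the mean oscillation of `f` over `(c, d)` and `m` for the mean, so that the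
hypothesis reads `|Df|(c, d) = 4 W(c, d)`.

*A continuous representative.* The left side is superadditive on adjacent intervals and
subadditive on overlapping ones, the right side is continuous in the end points; hence `W` is
additive (`HasQuarterVariation.additive`), and `|Df|` has no atoms. Testing against
differences of translated mollifiers bounds the increments of `f` by `4 W`, so `f` agrees almost
everywhere with a continuous function `g` (`HasQuarterVariation.exists_continuous_representative`).

*Monotonicity.* If `g d = m`, then moving `d` to the right changes `∫ |g - m|` only to second
order, while `W(c, d)` cannot decrease and the length grows; so `W(c, d) = 0`
(`HasQuarterOsc.meanOsc_eq_zero_of_right`). Therefore `g d - m` has one and the same sign on all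
intervals with `W > 0`. If it is positive, a minimum of `g` over a compact interval is attained at
the left end point, so `g` is nondecreasing; otherwise `-g` is. A flat piece next to a rise would
make `W` too small, so `g` is strictly monotone unless it is constant.

*Rigidity.* For increasing `g`, `4 W(c, d) = g d - g c`. Differentiating in both end points and
eliminating the mean of `sgn (g - m)` gives, with `A = g d - m` and `B = m - g c`,
`(d - c) (g'(d) B + g'(c) A) = 8 A B - (A + B) ^ 2` (`HasQuarterOsc.deriv_relation`). With `c`
fixed it makes `g` smooth. Its Taylor expansion as `d` decreases to `c` yields
`3 g' g''' = g'' ^ 2` at order two, and, with the derivatives of this identity,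
`g'' ^ 4 = 0` at order four (`second_deriv_eq_zero_of_relation`). So `g` is affine.
-/

open MeasureTheory Set Filter Topology

/-! ### Means and mean oscillations over intervals -/

/-- The mean of `f` over the interval with end points `c` and `d`, as an oriented integral: the
value is the same for both orders of the end points. -/
noncomputable def intervalMean (f : ℝ → ℝ) (c d : ℝ) : ℝ := (∫ x in c..d, f x) / (d - c)

/-- The mean oscillation of `f` over the interval with end points `c` and `d`, as an oriented
integral: the value is the same for both orders of the end points, and it is `0` if `c = d`. -/
noncomputable def meanOsc (f : ℝ → ℝ) (c d : ℝ) : ℝ :=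
  (∫ x in c..d, |f x - intervalMean f c d|) / (d - c)

lemma intervalMean_symm (f : ℝ → ℝ) (c d : ℝ) : intervalMean f c d = intervalMean f d c := by
  unfold intervalMean
  rw [intervalIntegral.integral_symm, ← neg_sub c d, neg_div_neg_eq]

lemma meanOsc_symm (f : ℝ → ℝ) (c d : ℝ) : meanOsc f c d = meanOsc f d c := by
  unfold meanOsc
  rw [intervalMean_symm f c d, intervalIntegral.integral_symm, ← neg_sub c d, neg_div_neg_eq]

lemma meanOsc_self (f : ℝ → ℝ) (c : ℝ) : meanOsc f c c = 0 := by simp [meanOsc]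

lemma meanOsc_nonneg {f : ℝ → ℝ} {c d : ℝ} (h : c ≤ d) : 0 ≤ meanOsc f c d :=
  div_nonneg (intervalIntegral.integral_nonneg h fun _ _ => abs_nonneg _) (sub_nonneg.2 h)

lemma osc_Ioo_eq_meanOsc (f : ℝ → ℝ) {c d : ℝ} (h : c < d) : osc f (Ioo c d) = meanOsc f c d := by
  have key : ∀ g : ℝ → ℝ, ⨍ x in Ioo c d, g x = (∫ x in c..d, g x) / (d - c) := by
    intro g
    rw [setAverage_eq, intervalIntegral.integral_of_le h.le, integral_Ioc_eq_integral_Ioo]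
    simp [h.le, div_eq_inv_mul]
  unfold osc meanOsc intervalMean
  rw [key, key]

lemma integral_eq_intervalMean_mul {f : ℝ → ℝ} {c d : ℝ} (h : c ≠ d) :
    ∫ x in c..d, f x = intervalMean f c d * (d - c) := by
  unfold intervalMean
  rw [div_mul_cancel₀ _ (sub_ne_zero.2 h.symm)]

lemma integral_abs_sub_mean {f : ℝ → ℝ} {c d : ℝ} (h : c ≠ d) :
    ∫ x in c..d, |f x - intervalMean f c d| = meanOsc f c d * (d - c) := by
  unfold meanOsc
  rw [div_mul_cancel₀ _ (sub_ne_zero.2 h.symm)]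

lemma intervalMean_congr {f g : ℝ → ℝ} {c d : ℝ} (hcd : c ≤ d)
    (h : ∀ᵐ x, x ∈ Ioo c d → f x = g x) : intervalMean f c d = intervalMean g c d := by
  unfold intervalMean
  rw [intervalIntegral.integral_of_le hcd, intervalIntegral.integral_of_le hcd,
    integral_Ioc_eq_integral_Ioo, integral_Ioc_eq_integral_Ioo,
    setIntegral_congr_ae measurableSet_Ioo h]

lemma meanOsc_congr {f g : ℝ → ℝ} {c d : ℝ} (hcd : c ≤ d)
    (h : ∀ᵐ x, x ∈ Ioo c d → f x = g x) : meanOsc f c d = meanOsc g c d := by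
  unfold meanOsc
  rw [intervalMean_congr hcd h, intervalIntegral.integral_of_le hcd,
    intervalIntegral.integral_of_le hcd, integral_Ioc_eq_integral_Ioo,
    integral_Ioc_eq_integral_Ioo]
  congr 1
  refine setIntegral_congr_ae measurableSet_Ioo ?_
  filter_upwards [h] with x hx hx'
  rw [hx hx']

lemma intervalMean_neg (f : ℝ → ℝ) (c d : ℝ) :
    intervalMean (fun x => -f x) c d = -intervalMean f c d := by
  simp [intervalMean, neg_div]

lemma meanOsc_neg (f : ℝ → ℝ) (c d : ℝ) : meanOsc (fun x => -f x) c d = meanOsc f c d := by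
  unfold meanOsc
  rw [intervalMean_neg]
  congr 2 with x
  rw [← abs_neg]
  congr 1
  ring

lemma intervalMean_comp_neg (f : ℝ → ℝ) (c d : ℝ) :
    intervalMean (fun x => f (-x)) c d = intervalMean f (-d) (-c) := by
  simp only [intervalMean, intervalIntegral.integral_comp_neg]
  congr 1
  ring

lemma meanOsc_comp_neg (f : ℝ → ℝ) (c d : ℝ) :
    meanOsc (fun x => f (-x)) c d = meanOsc f (-d) (-c) := by
  unfold meanOsc
  rw [intervalMean_comp_neg,
    intervalIntegral.integral_comp_neg (fun x => |f x - intervalMean f (-d) (-c)|)]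
  congr 1
  ring

/-- Moving the right end point and the subtracted constant changes `∫ |f - s|` in a controlled
way. -/
lemma abs_integral_abs_sub_sub_le {f : ℝ → ℝ} {c d e : ℝ} (s t : ℝ)
    (h1 : IntervalIntegrable f volume c d) (h2 : IntervalIntegrable f volume d e) :
    abs ((∫ x in c..e, |f x - t|) - ∫ x in c..d, |f x - s|)
      ≤ abs (∫ x in d..e, |f x - t|) + |t - s| * |d - c| := by
  have i1 : ∀ r, IntervalIntegrable (fun x => |f x - r|) volume c d := fun r =>
    (h1.sub intervalIntegrable_const).abs
  have i2 : ∀ r, IntervalIntegrable (fun x => |f x - r|) volume d e := fun r =>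
    (h2.sub intervalIntegrable_const).abs
  rw [← intervalIntegral.integral_add_adjacent_intervals (i1 t) (i2 t)]
  have h3 : |∫ x in c..d, (|f x - t| - |f x - s|)| ≤ |t - s| * |d - c| := by
    rw [← Real.norm_eq_abs (∫ x in _.._, _)]
    refine intervalIntegral.norm_integral_le_of_norm_le_const fun x _ => ?_
    rw [Real.norm_eq_abs]
    refine (abs_abs_sub_abs_le _ _).trans (le_of_eq ?_)
    rw [← abs_neg]
    congr 1
    ring
  rw [intervalIntegral.integral_sub (i1 t) (i1 s)] at h3
  have e1 : (∫ x in c..d, |f x - t|) + (∫ x in d..e, |f x - t|) - ∫ x in c..d, |f x - s|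
      = (∫ x in d..e, |f x - t|) + ((∫ x in c..d, |f x - t|) - ∫ x in c..d, |f x - s|) := by ring
  rw [e1]
  exact (abs_add_le _ _).trans (by linarith)

lemma intervalMean_sub_intervalMean {f : ℝ → ℝ} {c d e : ℝ} (hd : c ≠ d) (he : c ≠ e)
    (h1 : IntervalIntegrable f volume c d) (h2 : IntervalIntegrable f volume d e) :
    intervalMean f c e - intervalMean f c d
      = (∫ x in d..e, (f x - intervalMean f c d)) / (e - c) := by
  have h3 : e - c ≠ 0 := sub_ne_zero.2 he.symm
  rw [eq_div_iff h3, intervalIntegral.integral_sub h2 intervalIntegrable_const, sub_mul,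
    ← integral_eq_intervalMean_mul he, ← intervalIntegral.integral_add_adjacent_intervals h1 h2,
    integral_eq_intervalMean_mul hd]
  simp
  ring

lemma continuousAt_intervalMean {f : ℝ → ℝ} (hf : ∀ x y, IntervalIntegrable f volume x y)
    {c d : ℝ} (h : c ≠ d) : ContinuousAt (intervalMean f c) d := by
  unfold intervalMean
  exact ((intervalIntegral.continuous_primitive hf c).continuousAt).div (by fun_prop)
    (sub_ne_zero.2 h.symm)

lemma continuousAt_meanOsc {f : ℝ → ℝ} (hf : ∀ x y, IntervalIntegrable f volume x y)
    {c d : ℝ} (h : c ≠ d) : ContinuousAt (meanOsc f c) d := by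
  have hm := continuousAt_intervalMean hf h
  have hN : ContinuousAt (fun e => ∫ x in c..e, |f x - intervalMean f c e|) d := by
    rw [ContinuousAt, tendsto_iff_norm_sub_tendsto_zero]
    have hbound : ∀ e, ‖(∫ x in c..e, |f x - intervalMean f c e|) -
        ∫ x in c..d, |f x - intervalMean f c d|‖ ≤
        abs (∫ x in d..e, |f x|) + |intervalMean f c e| * |e - d| +
          |intervalMean f c e - intervalMean f c d| * |d - c| := by
      intro e
      refine (abs_integral_abs_sub_sub_le _ _ (hf c d) (hf d e)).trans ?_
      gcongr
      have h4 : |∫ x in d..e, (|f x - intervalMean f c e| - |f x|)|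
          ≤ |intervalMean f c e| * |e - d| := by
        rw [← Real.norm_eq_abs (∫ x in _.._, _)]
        refine intervalIntegral.norm_integral_le_of_norm_le_const fun x _ => ?_
        rw [Real.norm_eq_abs]
        refine (abs_abs_sub_abs_le _ _).trans (le_of_eq ?_)
        rw [← abs_neg]
        congr 1
        ring
      rw [intervalIntegral.integral_sub ((hf d e).sub intervalIntegrable_const).abs
        (hf d e).abs] at h4
      calc abs (∫ x in d..e, |f x - intervalMean f c e|)
          = abs ((∫ x in d..e, |f x|) +
            ((∫ x in d..e, |f x - intervalMean f c e|) - ∫ x in d..e, |f x|)) := by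
            rw [add_sub_cancel]
        _ ≤ _ := (abs_add_le _ _).trans (by linarith)
    refine squeeze_zero (fun _ => norm_nonneg _) hbound ?_
    have c1 : ContinuousAt (fun e => abs (∫ x in d..e, |f x|) + |intervalMean f c e| * |e - d| +
          |intervalMean f c e - intervalMean f c d| * |d - c|) d := by
      have := (intervalIntegral.continuous_primitive (fun x y => (hf x y).abs) d).continuousAt
        (x := d)
      fun_prop
    simpa [ContinuousAt] using c1
  unfold meanOsc
  exact hN.div (by fun_prop) (sub_ne_zero.2 h.symm)

/-- The mean oscillation is at most twice the mean of `|f - k|`, for every constant `k`. -/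
lemma meanOsc_mul_le {f : ℝ → ℝ} {c d : ℝ} (h : c < d) (hf : IntervalIntegrable f volume c d)
    (k : ℝ) : meanOsc f c d * (d - c) ≤ 2 * ∫ x in c..d, |f x - k| := by
  rw [← integral_abs_sub_mean h.ne]
  have h1 : |k - intervalMean f c d| * |d - c| ≤ ∫ x in c..d, |f x - k| := by
    rw [← abs_mul]
    have : (k - intervalMean f c d) * (d - c) = -∫ x in c..d, (f x - k) := by
      rw [intervalIntegral.integral_sub hf intervalIntegrable_const,
        integral_eq_intervalMean_mul h.ne]
      simp
      ring
    rw [this, abs_neg]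
    exact intervalIntegral.abs_integral_le_integral_abs h.le
  have h2 := abs_integral_abs_sub_sub_le (e := d) k (intervalMean f c d) hf (by simp)
  rw [intervalIntegral.integral_same, abs_zero, zero_add, abs_sub_comm (intervalMean f c d)] at h2
  linarith [(abs_le.1 h2).2]

lemma meanOsc_eq_zero_of_const {f : ℝ → ℝ} {c d k : ℝ} (h : c ≤ d)
    (hf : ∀ x ∈ Ioo c d, f x = k) : meanOsc f c d = 0 := by
  rcases h.eq_or_lt with rfl | h'
  · exact meanOsc_self f c
  rw [meanOsc_congr (g := fun _ => k) h (Eventually.of_forall hf)]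
  have : d - c ≠ 0 := (sub_pos.2 h').ne'
  have : intervalMean (fun _ => k) c d = k := by
    unfold intervalMean
    simp
    field_simp
  simp [meanOsc, this]

/-! ### Additive mean oscillation forces monotonicity -/

/-- What is retained of the hypothesis `osc(f, I) = |Df|(I) / 4` once `f` is replaced by its
continuous representative `g`: the mean oscillation is additive on adjacent intervals, and
`|Dg|(I) = 4 osc(g, I)` is at least the increment of `g`, with equality where `g` is monotone and
Lipschitz. -/
structure HasQuarterOsc (g : ℝ → ℝ) (a b : ℝ) : Prop where
  cont : ContinuousOn g (Ioo a b)
  add : ∀ x y z, a < x → x < y → y < z → z < b →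
    meanOsc g x z = meanOsc g x y + meanOsc g y z
  low : ∀ x y, a < x → x < y → y < b → |g y - g x| ≤ 4 * meanOsc g x y
  up : ∀ x y K, a < x → x < y → y < b → LipschitzOnWith K g (Icc x y) →
    (MonotoneOn g (Icc x y) ∨ AntitoneOn g (Icc x y)) → 4 * meanOsc g x y ≤ |g y - g x|

namespace HasQuarterOsc

variable {g : ℝ → ℝ} {a b : ℝ}

lemma neg (h : HasQuarterOsc g a b) : HasQuarterOsc (fun x => -g x) a b where
  cont := h.cont.neg
  add x y z := by simpa only [meanOsc_neg] using h.add x y z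
  low x y h1 h2 h3 := by
    rw [meanOsc_neg, ← abs_neg]
    convert h.low x y h1 h2 h3 using 2
    ring
  up x y K h1 h2 h3 hK hm := by
    rw [meanOsc_neg, ← abs_neg]
    convert h.up x y K h1 h2 h3 ?_ ?_ using 2
    · ring
    · exact fun u hu v hv => by simpa using hK hu hv
    · rcases hm with hm | hm
      · exact Or.inr (by simpa using hm.neg)
      · exact Or.inl (by simpa using hm.neg)

lemma comp_neg (h : HasQuarterOsc g a b) : HasQuarterOsc (fun x => g (-x)) (-b) (-a) where
  cont := h.cont.comp continuousOn_neg fun x hx => by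
    constructor <;> linarith [hx.1, hx.2]
  add x y z h1 h2 h3 h4 := by
    simp only [meanOsc_comp_neg]
    rw [h.add (-z) (-y) (-x) (by linarith) (by linarith) (by linarith) (by linarith), add_comm]
  low x y h1 h2 h3 := by
    rw [meanOsc_comp_neg, abs_sub_comm]
    exact h.low (-y) (-x) (by linarith) (by linarith) (by linarith)
  up x y K h1 h2 h3 hK hm := by
    have hmaps : ∀ z ∈ Icc (-y) (-x), -z ∈ Icc x y := fun z hz => by
      constructor <;> linarith [hz.1, hz.2]
    rw [meanOsc_comp_neg, abs_sub_comm]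
    refine h.up (-y) (-x) K (by linarith) (by linarith) (by linarith) ?_ ?_
    · intro u hu v hv
      simpa using hK (hmaps u hu) (hmaps v hv)
    · rcases hm with hm | hm
      · refine Or.inr fun u hu v hv huv => ?_
        simpa using hm (hmaps v hv) (hmaps u hu) (neg_le_neg huv)
      · refine Or.inl fun u hu v hv huv => ?_
        simpa using hm (hmaps v hv) (hmaps u hu) (neg_le_neg huv)

lemma intervalIntegrable (h : HasQuarterOsc g a b) {x y : ℝ} (hx : x ∈ Ioo a b)
    (hy : y ∈ Ioo a b) : IntervalIntegrable g volume x y :=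
  (h.cont.mono ((convex_Ioo a b).ordConnected.uIcc_subset hx hy)).intervalIntegrable

lemma continuousAt (h : HasQuarterOsc g a b) {x : ℝ} (hx : x ∈ Ioo a b) : ContinuousAt g x :=
  h.cont.continuousAt (isOpen_Ioo.mem_nhds hx)

lemma hasDerivAt_integral (h : HasQuarterOsc g a b) {x y : ℝ} (hx : x ∈ Ioo a b)
    (hy : y ∈ Ioo a b) : HasDerivAt (fun u => ∫ t in x..u, g t) (g y) y :=
  intervalIntegral.integral_hasDerivAt_right (h.intervalIntegrable hx hy)
    (h.cont.stronglyMeasurableAtFilter isOpen_Ioo y hy) (h.continuousAt hy)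

lemma meanOsc_mono (h : HasQuarterOsc g a b) {c d c' d' : ℝ} (h1 : a < c') (h2 : c' ≤ c)
    (h3 : c < d) (h4 : d ≤ d') (h5 : d' < b) : meanOsc g c d ≤ meanOsc g c' d' := by
  have e1 : meanOsc g c d ≤ meanOsc g c d' := by
    rcases h4.eq_or_lt with rfl | h4
    · exact le_rfl
    · rw [h.add c d d' (by linarith) h3 h4 h5]
      linarith [meanOsc_nonneg (f := g) h4.le]
  refine e1.trans ?_
  rcases h2.eq_or_lt with rfl | h2
  · exact le_rfl
  · rw [h.add c' c d' (by linarith) h2 (by linarith) h5]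
    linarith [meanOsc_nonneg (f := g) h2.le]

/-- If the mean over `(c, d)` is attained at the end point `d`, then moving `d` to the right
changes the mean only to second order, so that the quotient `meanOsc g c d` would decrease unless
it vanishes. -/
lemma meanOsc_eq_zero_of_right (h : HasQuarterOsc g a b) {c d : ℝ} (hc : a < c) (hcd : c < d)
    (hd : d < b) (hm : g d = intervalMean g c d) : meanOsc g c d = 0 := by
  by_contra hne
  have hW : 0 < meanOsc g c d := lt_of_le_of_ne (meanOsc_nonneg hcd.le) (Ne.symm hne)
  set W := meanOsc g c d with hWdef
  set m := intervalMean g c d with hmdef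
  have hcI : c ∈ Ioo a b := ⟨hc, hcd.trans hd⟩
  have hdI : d ∈ Ioo a b := ⟨hc.trans hcd, hd⟩
  have hev : ∀ᶠ x in 𝓝 d, |g x - g d| < W / 4 ∧ x < b :=
    ((h.continuousAt hdI).eventually (Metric.ball_mem_nhds _ (by positivity))).and
      (Iio_mem_nhds hd)
  obtain ⟨δ, hδ, hball⟩ := Metric.eventually_nhds_iff.1 hev
  set e := d + δ / 2 with hedef
  have hde : d < e := by linarith
  have hnear : ∀ x ∈ Icc d e, |g x - m| ≤ W / 4 := by
    intro x hx
    rw [← hm]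
    refine (hball ?_).1.le
    rw [Real.dist_eq, abs_of_nonneg (by linarith [hx.1])]
    linarith [hx.2]
  have heb : e < b := by
    refine (hball ?_).2
    rw [Real.dist_eq, abs_of_nonneg (by linarith)]
    linarith
  have heI : e ∈ Ioo a b := ⟨by linarith, heb⟩
  set m' := intervalMean g c e with hm'def
  have hmm : |m' - m| * (e - c) ≤ W / 4 * (e - d) := by
    rw [hm'def, hmdef, intervalMean_sub_intervalMean hcd.ne (hcd.trans hde).ne
      (h.intervalIntegrable hcI hdI) (h.intervalIntegrable hdI heI), ← hmdef, abs_div,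
      abs_of_pos (show 0 < e - c by linarith), div_mul_cancel₀ _ (show e - c ≠ 0 by linarith)]
    have := intervalIntegral.norm_integral_le_of_norm_le_const (a := d) (b := e)
      (f := fun x => g x - m) (C := W / 4) fun x hx => by
        rw [uIoc_of_le hde.le] at hx
        exact hnear x ⟨hx.1.le, hx.2⟩
    rwa [abs_of_pos (show 0 < e - d by linarith)] at this
  have hint : abs (∫ x in d..e, |g x - m'|) ≤ (W / 4 + |m' - m|) * (e - d) := by
    have := intervalIntegral.norm_integral_le_of_norm_le_const (a := d) (b := e)
      (f := fun x => |g x - m'|) (C := W / 4 + |m' - m|) fun x hx => by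
        rw [uIoc_of_le hde.le] at hx
        rw [Real.norm_eq_abs, abs_abs, abs_sub_comm m' m]
        calc |g x - m'| = |(g x - m) + (m - m')| := by ring_nf
          _ ≤ _ := (abs_add_le _ _).trans (by linarith [hnear x ⟨hx.1.le, hx.2⟩])
    rwa [abs_of_pos (show 0 < e - d by linarith)] at this
  have hkey := abs_integral_abs_sub_sub_le m m' (h.intervalIntegrable hcI hdI)
    (h.intervalIntegrable hdI heI)
  rw [hmdef, hm'def, integral_abs_sub_mean hcd.ne, integral_abs_sub_mean (hcd.trans hde).ne,
    ← hWdef, ← hmdef, ← hm'def, abs_of_pos (show 0 < d - c by linarith)] at hkey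
  have hmono : W ≤ meanOsc g c e := h.meanOsc_mono hc le_rfl hcd hde.le heb
  have h1 : W * (e - c) ≤ meanOsc g c e * (e - c) :=
    mul_le_mul_of_nonneg_right hmono (by linarith)
  have h2 := (abs_le.1 hkey).2
  have h3 : 0 < W * (e - d) := mul_pos hW (by linarith)
  nlinarith

lemma exists_primitive (h : HasQuarterOsc g a b) : ∃ G : ℝ → ℝ,
    (∀ x ∈ Ioo a b, HasDerivAt G (g x) x) ∧
      ∀ x ∈ Ioo a b, ∀ y ∈ Ioo a b, ∫ t in x..y, g t = G y - G x := by
  rcases (Ioo a b).eq_empty_or_nonempty with he | ⟨x₀, hx₀⟩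
  · exact ⟨0, by simp [he], by simp [he]⟩
  · refine ⟨fun u => ∫ t in x₀..u, g t, fun x hx => h.hasDerivAt_integral hx₀ hx,
      fun x hx y hy => ?_⟩
    rw [intervalIntegral.integral_interval_sub_left (h.intervalIntegrable hx₀ hy)
      (h.intervalIntegrable hx₀ hx)]

/-- On the intervals of positive mean oscillation, the sign of `g d - intervalMean g c d` does not
change when the interval is enlarged. -/
lemma sign_enlarge (h : HasQuarterOsc g a b) {c d c' d' : ℝ} (h1 : a < c') (h2 : c' ≤ c)
    (h3 : c < d) (h4 : d ≤ d') (h5 : d' < b) (hW : 0 < meanOsc g c d) :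
    0 < (g d - intervalMean g c d) * (g d' - intervalMean g c' d') := by
  obtain ⟨G, hG, hGi⟩ := h.exists_primitive
  set C : ℝ → ℝ := fun l => c + l * (c' - c) with hC
  set D : ℝ → ℝ := fun l => d + l * (d' - d) with hD
  have hCm : ∀ l ∈ Icc (0 : ℝ) 1, c' ≤ C l ∧ C l ≤ c := fun l hl => by
    constructor <;> simp only [hC] <;> nlinarith [hl.1, hl.2]
  have hDm : ∀ l ∈ Icc (0 : ℝ) 1, d ≤ D l ∧ D l ≤ d' := fun l hl => by
    constructor <;> simp only [hD] <;> nlinarith [hl.1, hl.2]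
  have hCI : ∀ l ∈ Icc (0 : ℝ) 1, C l ∈ Ioo a b := fun l hl => by
    constructor <;> linarith [hCm l hl]
  have hDI : ∀ l ∈ Icc (0 : ℝ) 1, D l ∈ Ioo a b := fun l hl => by
    constructor <;> linarith [hDm l hl]
  set s : ℝ → ℝ := fun l => g (D l) - intervalMean g (C l) (D l) with hs
  have hne : ∀ l ∈ Icc (0 : ℝ) 1, s l ≠ 0 := by
    intro l hl h0
    obtain ⟨q1, q2⟩ := hCm l hl
    obtain ⟨q3, q4⟩ := hDm l hl
    have := h.meanOsc_eq_zero_of_right (by linarith) (by linarith : C l < D l) (by linarith)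
      (sub_eq_zero.1 h0)
    linarith [h.meanOsc_mono (by linarith : a < C l) q2 h3 q3 (by linarith)]
  have hGc : ContinuousOn G (Ioo a b) := fun x hx => (hG x hx).continuousAt.continuousWithinAt
  have hCc : ContinuousOn C (Icc 0 1) := by fun_prop
  have hDc : ContinuousOn D (Icc 0 1) := by fun_prop
  have hsc : ContinuousOn s (Icc 0 1) := by
    have : ContinuousOn (fun l => g (D l) - (G (D l) - G (C l)) / (D l - C l)) (Icc 0 1) :=
      (h.cont.comp hDc hDI).sub (((hGc.comp hDc hDI).sub (hGc.comp hCc hCI)).div (hDc.sub hCc)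
        fun l hl => by linarith [hCm l hl, hDm l hl])
    refine this.congr fun l hl => ?_
    simp only [hs, intervalMean]
    rw [hGi _ (hCI l hl) _ (hDI l hl)]
  have hs0 : s 0 = g d - intervalMean g c d := by simp [hs, hC, hD]
  have hs1 : s 1 = g d' - intervalMean g c' d' := by simp [hs, hC, hD]
  rw [← hs0, ← hs1]
  rcases lt_or_gt_of_ne (hne 0 (by simp)) with n0 | n0 <;>
    rcases lt_or_gt_of_ne (hne 1 (by simp)) with n1 | n1
  · exact mul_pos_of_neg_of_neg n0 n1
  · obtain ⟨l, hl, hl0⟩ := intermediate_value_Icc zero_le_one hsc ⟨n0.le, n1.le⟩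
    exact absurd hl0 (hne l hl)
  · obtain ⟨l, hl, hl0⟩ := intermediate_value_Icc' zero_le_one hsc ⟨n1.le, n0.le⟩
    exact absurd hl0 (hne l hl)
  · exact mul_pos n0 n1

lemma sign_const (h : HasQuarterOsc g a b) {c d c' d' : ℝ} (hc : a < c) (hcd : c < d)
    (hd : d < b) (hW : 0 < meanOsc g c d) (hc' : a < c') (hcd' : c' < d') (hd' : d' < b)
    (hW' : 0 < meanOsc g c' d') (hpos : 0 < g d - intervalMean g c d) :
    0 < g d' - intervalMean g c' d' := by
  have h1 := h.sign_enlarge (lt_min hc hc') (min_le_left c c') hcd (le_max_left d d')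
    (max_lt hd hd') hW
  have h2 := h.sign_enlarge (lt_min hc hc') (min_le_right c c') hcd' (le_max_right d d')
    (max_lt hd hd') hW'
  have h3 := (pos_iff_pos_of_mul_pos h1).1 hpos
  exact (pos_iff_pos_of_mul_pos h2).2 h3

lemma le_intervalMean {c d k : ℝ} (hcd : c < d) (hg : IntervalIntegrable g volume c d)
    (hk : ∀ x ∈ Icc c d, k ≤ g x) : k ≤ intervalMean g c d := by
  unfold intervalMean
  rw [le_div_iff₀ (sub_pos.2 hcd)]
  have := intervalIntegral.integral_mono_on hcd.le intervalIntegrable_const hg hk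
  simpa [mul_comm] using this

lemma monotoneOn (h : HasQuarterOsc g a b)
    (hpos : ∀ c d, a < c → c < d → d < b → 0 < meanOsc g c d → 0 < g d - intervalMean g c d) :
    MonotoneOn g (Ioo a b) := by
  intro x hx y hy hxy
  obtain ⟨q, hq, hmin⟩ := isCompact_Icc.exists_isMinOn (nonempty_Icc.2 hxy)
    (h.cont.mono fun z hz => ⟨hx.1.trans_le hz.1, hz.2.trans_lt hy.2⟩)
  have hmin' : ∀ z ∈ Icc x y, g q ≤ g z := fun z hz => hmin hz
  -- the minimum over `[x, y]` cannot lie to the right of a rise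
  have hqx : g x = g q := by
    rcases hq.1.eq_or_lt with rfl | hxq
    · rfl
    have hqb : q < b := hq.2.trans_lt hy.2
    rcases (meanOsc_nonneg (f := g) hxq.le).eq_or_lt with h0 | hW
    · have := h.low x q hx.1 hxq hqb
      rw [← h0, mul_zero] at this
      exact (sub_eq_zero.1 (abs_nonpos_iff.1 this)).symm
    · have h1 := hpos x q hx.1 hxq hqb hW
      have h2 := le_intervalMean hxq (h.intervalIntegrable hx ⟨hx.1.trans hxq, hqb⟩)
        fun z hz => hmin' z ⟨hz.1, hz.2.trans hq.2⟩
      linarith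
  rw [hqx]
  exact hmin' y ⟨hxy, le_rfl⟩

/-- A flat piece cannot be followed by a rise: just after the flat piece `(x, e)` the mean
oscillation over `(x, d)` is at most `2 (d - e) / (d - x) * (g d - g e)`, too small for the
increment `g d - g e`. -/
lemma eq_of_flat_left (h : HasQuarterOsc g a b) (hmono : MonotoneOn g (Ioo a b)) {x y z : ℝ}
    (hx : a < x) (hxy : x < y) (hyz : y < z) (hz : z < b) (hflat : g x = g y) : g z = g x := by
  by_contra hne
  have hI : ∀ t ∈ Icc x z, t ∈ Ioo a b := fun t ht => ⟨hx.trans_le ht.1, ht.2.trans_lt hz⟩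
  have hcomp : IsCompact (Icc y z ∩ g ⁻¹' {g x}) := by
    refine isCompact_Icc.of_isClosed_subset ?_ inter_subset_left
    exact (h.cont.mono fun t ht => hI t ⟨hxy.le.trans ht.1, ht.2⟩).preimage_isClosed_of_isClosed
      isClosed_Icc isClosed_singleton
  obtain ⟨e, ⟨⟨hye, hez⟩, hge⟩, hmax⟩ := hcomp.exists_isGreatest ⟨y, ⟨le_rfl, hyz.le⟩, hflat.symm⟩
  have hge : g e = g x := hge
  have hez : e < z := lt_of_le_of_ne hez fun q => hne (q ▸ hge)
  have hxe : x < e := hxy.trans_le hye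
  -- `d - e < (d - x) / 8` makes `2 (d - e) / (d - x)` smaller than `1 / 4`
  set d := min z (e + (e - x) / 8) with hd
  have hed : e < d := lt_min hez (by linarith)
  have hdz : d ≤ z := min_le_left _ _
  have hd8 : d ≤ e + (e - x) / 8 := min_le_right _ _
  have hdI := hI d ⟨by linarith, hdz⟩
  have heI := hI e ⟨hxe.le, hez.le⟩
  have hxI := hI x ⟨le_rfl, by linarith⟩
  have hgd : g x < g d := by
    refine lt_of_le_of_ne (hmono hxI hdI (by linarith)) fun q => ?_
    exact absurd (hmax ⟨⟨by linarith, hdz⟩, q.symm⟩) (not_le.2 hed)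
  have hW1 := h.low e d heI.1 hed hdI.2
  rw [hge, abs_of_pos (sub_pos.2 hgd)] at hW1
  have hW2 := h.meanOsc_mono hx hxe.le hed le_rfl hdI.2
  have hW3 := meanOsc_mul_le (hxe.trans hed) (h.intervalIntegrable hxI hdI) (g x)
  have hi : ∀ u ∈ Ioo a b, ∀ v ∈ Ioo a b, IntervalIntegrable (fun t => |g t - g x|) volume u v :=
    fun u hu v hv => ((h.intervalIntegrable hu hv).sub intervalIntegrable_const).abs
  have hI1 : ∫ t in x..e, |g t - g x| = 0 := by
    rw [intervalIntegral.integral_congr (g := fun _ => (0 : ℝ))]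
    · simp
    · intro t ht
      rw [uIcc_of_le hxe.le] at ht
      have htI := hI t ⟨ht.1, ht.2.trans hez.le⟩
      have : g t = g x :=
        le_antisymm (hge ▸ hmono htI heI ht.2) (hmono hxI htI ht.1)
      simp [this]
  have hI2 : ∫ t in e..d, |g t - g x| ≤ (g d - g x) * (d - e) := by
    have := intervalIntegral.integral_mono_on hed.le (hi e heI d hdI)
      (intervalIntegrable_const (c := g d - g x)) fun t ht => by
        have htI := hI t ⟨hxe.le.trans ht.1, ht.2.trans hdz⟩
        rw [abs_of_nonneg (sub_nonneg.2 (hmono hxI htI (hxe.le.trans ht.1)))]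
        linarith [hmono htI hdI ht.2]
    rw [intervalIntegral.integral_const, smul_eq_mul] at this
    linarith
  rw [← intervalIntegral.integral_add_adjacent_intervals (hi x hxI e heI) (hi e heI d hdI), hI1,
    zero_add] at hW3
  have h4 : (g d - g x) / 4 * (d - x) ≤ meanOsc g x d * (d - x) :=
    mul_le_mul_of_nonneg_right (by linarith) (by linarith)
  nlinarith [mul_pos (sub_pos.2 hgd) (sub_pos.2 hxe)]

lemma strictMonoOn (h : HasQuarterOsc g a b) (hmono : MonotoneOn g (Ioo a b)) {c d : ℝ}
    (hc : a < c) (hcd : c < d) (hd : d < b) (hW : 0 < meanOsc g c d) :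
    StrictMonoOn g (Ioo a b) := by
  intro x hx y hy hxy
  refine lt_of_le_of_ne (hmono hx hy hxy.le) fun hflat => ?_
  have hr : ∀ z, y < z → z < b → g z = g x := fun z h1 h2 =>
    h.eq_of_flat_left hmono hx.1 hxy h1 h2 hflat
  have hl : ∀ z, a < z → z < x → g z = g x := by
    intro z h1 h2
    have hmono' : MonotoneOn (fun t => -g (-t)) (Ioo (-b) (-a)) := by
      intro u hu v hv huv
      refine neg_le_neg (hmono ⟨by linarith [hv.2], by linarith [hv.1]⟩
        ⟨by linarith [hu.2], by linarith [hu.1]⟩ (neg_le_neg huv))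
    have := h.comp_neg.neg.eq_of_flat_left hmono' (x := -y) (y := -x) (z := -z)
      (by linarith [hy.2]) (by linarith) (by linarith) (by linarith) (by simp [hflat])
    simp only [neg_neg, neg_inj] at this
    rw [this, hflat]
  have hconst : ∀ z ∈ Ioo a b, g z = g x := by
    intro z hz
    rcases lt_or_ge z x with h1 | h1
    · exact hl z hz.1 h1
    rcases lt_or_ge y z with h2 | h2
    · exact hr z h2 hz.2
    · exact le_antisymm (hflat ▸ hmono hz hy h2) (hmono hx hz h1)
  refine hW.ne' (meanOsc_eq_zero_of_const (k := g x) hcd.le fun t ht => hconst t ?_)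
  exact ⟨hc.trans ht.1, ht.2.trans hd⟩

end HasQuarterOsc

/-! ### Differentiating the mean oscillation in an end point -/

/-- The mean of `sgn (g - m)` over the interval with end points `c` and `d`, where `m` is the mean
of `g` (with the value `-1` at `0`, which is immaterial when `g = m` on a null set only). -/
noncomputable def signMean (g : ℝ → ℝ) (c d : ℝ) : ℝ :=
  (∫ x in c..d, if intervalMean g c d < g x then (1 : ℝ) else -1) / (d - c)

lemma signMean_symm (g : ℝ → ℝ) (c d : ℝ) : signMean g c d = signMean g d c := by
  unfold signMean
  rw [intervalMean_symm g c d, intervalIntegral.integral_symm, ← neg_sub c d, neg_div_neg_eq]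

lemma hasDerivAt_integral_abs_sub {g : ℝ → ℝ} {c d m : ℝ} (hg : IntervalIntegrable g volume c d)
    (hm : ∀ᵐ x, x ∈ uIoc c d → g x ≠ m) :
    HasDerivAt (fun s => ∫ x in c..d, |g x - s|)
      (-∫ x in c..d, if m < g x then (1 : ℝ) else -1) m := by
  have hmeas : AEStronglyMeasurable g (volume.restrict (uIoc c d)) :=
    hg.aestronglyMeasurable_restrict_uIoc
  have := (intervalIntegral.hasDerivAt_integral_of_dominated_loc_of_lip (μ := volume) (a := c)
    (b := d) (F := fun s x => |g x - s|) (F' := fun x => -if m < g x then (1 : ℝ) else -1)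
    (x₀ := m) (s := univ) (bound := fun _ => 1) univ_mem
    (Eventually.of_forall fun s => (hmeas.sub aestronglyMeasurable_const).norm)
    (hg.sub intervalIntegrable_const).abs ?_ ?_ intervalIntegrable_const ?_).2
  · simpa only [intervalIntegral.integral_neg] using this
  · have h1 : Measurable fun y : ℝ => -if m < y then (1 : ℝ) else -1 :=
      (Measurable.ite measurableSet_Ioi measurable_const measurable_const).neg
    exact (h1.comp_aemeasurable hmeas.aemeasurable).aestronglyMeasurable
  · refine Eventually.of_forall fun x _ => LipschitzOnWith.of_dist_le_mul fun s _ t _ => ?_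
    simp only [Real.dist_eq, Real.coe_nnabs, abs_one, one_mul]
    refine (abs_abs_sub_abs_le _ _).trans (le_of_eq ?_)
    rw [← abs_neg]
    congr 1
    ring
  · filter_upwards [hm] with x hx hxI
    have h1 : HasDerivAt (fun s => g x - s) (-1) m := by
      simpa using (hasDerivAt_id m).const_sub (g x)
    rcases lt_or_gt_of_ne (hx hxI) with h2 | h2
    · simpa [not_lt.2 h2.le, Function.comp_def] using
        (hasDerivAt_abs_neg (sub_neg.2 h2)).comp m h1
    · simpa [h2, Function.comp_def] using (hasDerivAt_abs_pos (sub_pos.2 h2)).comp m h1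

namespace HasQuarterOsc

variable {g : ℝ → ℝ} {a b : ℝ}

lemma hasDerivAt_intervalMean (h : HasQuarterOsc g a b) {c d : ℝ} (hc : c ∈ Ioo a b)
    (hd : d ∈ Ioo a b) (hcd : c ≠ d) :
    HasDerivAt (intervalMean g c) ((g d - intervalMean g c d) / (d - c)) d := by
  have h0 : d - c ≠ 0 := sub_ne_zero.2 hcd.symm
  refine HasDerivAt.congr_deriv
    ((h.hasDerivAt_integral hc hd).fun_div ((hasDerivAt_id d).sub_const c) h0) ?_
  rw [integral_eq_intervalMean_mul hcd]
  field_simp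

/-- The derivative of the mean oscillation in one end point, when the mean is attained on a null
set only. By `meanOsc_symm` and `signMean_symm` this covers both end points. -/
lemma hasDerivAt_meanOsc (h : HasQuarterOsc g a b) {c d : ℝ} (hc : c ∈ Ioo a b)
    (hd : d ∈ Ioo a b) (hcd : c ≠ d) (hm : ∀ᵐ x, x ∈ uIoc c d → g x ≠ intervalMean g c d) :
    HasDerivAt (meanOsc g c) ((|g d - intervalMean g c d| -
      (g d - intervalMean g c d) * signMean g c d - meanOsc g c d) / (d - c)) d := by
  have h0 : d - c ≠ 0 := sub_ne_zero.2 hcd.symm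
  have hmd := h.hasDerivAt_intervalMean hc hd hcd
  have hi : ∀ e ∈ Ioo a b, ∀ s, IntervalIntegrable (fun x => |g x - s|) volume d e :=
    fun e he s => ((h.intervalIntegrable hd he).sub intervalIntegrable_const).abs
  have d1 := (hasDerivAt_integral_abs_sub (h.intervalIntegrable hc hd) hm).comp d hmd
  have d2 : HasDerivAt (fun e => ∫ x in d..e, |g x - intervalMean g c d|)
      |g d - intervalMean g c d| d := by
    have hcont : ContinuousOn (fun x => |g x - intervalMean g c d|) (Ioo a b) :=
      (h.cont.sub continuousOn_const).abs
    exact intervalIntegral.integral_hasDerivAt_right (hi d hd _)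
      (hcont.stronglyMeasurableAtFilter isOpen_Ioo d hd)
      (hcont.continuousAt (isOpen_Ioo.mem_nhds hd))
  have d3 : HasDerivAt (fun e => (∫ x in d..e, |g x - intervalMean g c e|) -
      ∫ x in d..e, |g x - intervalMean g c d|) 0 d := by
    rw [hasDerivAt_iff_isLittleO]
    refine Asymptotics.IsLittleO.of_bound fun ε hε => ?_
    filter_upwards [hmd.continuousAt.eventually (Metric.ball_mem_nhds _ hε),
      isOpen_Ioo.mem_nhds hd] with e he heI
    have he : |intervalMean g c e - intervalMean g c d| < ε := he
    have hb := intervalIntegral.norm_integral_le_of_norm_le_const (a := d) (b := e)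
      (f := fun x => |g x - intervalMean g c e| - |g x - intervalMean g c d|)
      (C := |intervalMean g c e - intervalMean g c d|) fun x _ => by
        refine (abs_abs_sub_abs_le _ _).trans (le_of_eq ?_)
        rw [← abs_neg]
        congr 1
        ring
    rw [intervalIntegral.integral_sub (hi e heI _) (hi e heI _)] at hb
    simp only [intervalIntegral.integral_same, sub_zero, smul_zero]
    refine hb.trans ?_
    rw [Real.norm_eq_abs]
    gcongr
  have hN := (d1.add d2).add d3
  have hN' : HasDerivAt (fun e => ∫ x in c..e, |g x - intervalMean g c e|)
      (-(∫ x in c..d, if intervalMean g c d < g x then (1 : ℝ) else -1) *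
        ((g d - intervalMean g c d) / (d - c)) + |g d - intervalMean g c d| + 0) d := by
    refine hN.congr_of_eventuallyEq ?_
    filter_upwards [isOpen_Ioo.mem_nhds hd] with e he
    simp only [Pi.add_apply, Function.comp_apply]
    rw [← intervalIntegral.integral_add_adjacent_intervals
      ((h.intervalIntegrable hc hd).sub intervalIntegrable_const).abs (hi e he _)]
    ring
  refine HasDerivAt.congr_deriv (hN'.fun_div ((hasDerivAt_id d).sub_const c) h0) ?_
  rw [integral_abs_sub_mean hcd, signMean]
  field_simp
  ring

/-- A monotone function of this kind is Lipschitz on compact subintervals, because its mean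
oscillation over `(c, v)` is a Lipschitz function of `v`. -/
lemma exists_lipschitzOnWith (h : HasQuarterOsc g a b) (hmono : MonotoneOn g (Ioo a b)) {x y : ℝ}
    (hx : a < x) (hxy : x < y) (hy : y < b) : ∃ K, LipschitzOnWith K g (Icc x y) := by
  set c := (a + x) / 2 with hc
  have hac : a < c := by linarith
  have hcx : c < x := by linarith
  have hI : ∀ t ∈ Icc c y, t ∈ Ioo a b := fun t ht => ⟨hac.trans_le ht.1, ht.2.trans_lt hy⟩
  have hcI := hI c ⟨le_rfl, by linarith⟩
  obtain ⟨M, hM⟩ := isCompact_Icc.exists_bound_of_continuousOn (h.cont.mono hI)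
  have hM0 : 0 ≤ M := (norm_nonneg _).trans (hM c ⟨le_rfl, by linarith⟩)
  have key : ∀ u v, x ≤ u → u < v → v ≤ y → g v ≤ g u + 16 * M / (x - c) * (v - u) := by
    intro u v hu huv hv
    have hcu : c < u := hcx.trans_le hu
    have hcv : c < v := hcu.trans huv
    have huI := hI u ⟨hcu.le, huv.le.trans hv⟩
    have hvI := hI v ⟨hcv.le, hv⟩
    have hmb : ∀ w, c < w → w ≤ y → |intervalMean g c w| ≤ M := by
      intro w hw hwy
      unfold intervalMean
      rw [abs_div, div_le_iff₀ (abs_pos.2 (sub_pos.2 hw).ne')]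
      rw [← Real.norm_eq_abs (∫ t in _.._, _)]
      refine intervalIntegral.norm_integral_le_of_norm_le_const fun t ht => ?_
      rw [uIoc_of_le hw.le] at ht
      exact hM t ⟨ht.1.le, ht.2.trans hwy⟩
    have hvm := hmb v hcv hv
    have hum := hmb u hcu (huv.le.trans hv)
    have e1 : abs (∫ t in u..v, |g t - intervalMean g c v|) ≤ 2 * M * (v - u) := by
      have := intervalIntegral.norm_integral_le_of_norm_le_const (a := u) (b := v)
        (f := fun t => |g t - intervalMean g c v|) (C := 2 * M) fun t ht => by
          rw [uIoc_of_le huv.le] at ht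
          rw [Real.norm_eq_abs, abs_abs]
          have := hM t ⟨hcu.le.trans ht.1.le, ht.2.trans hv⟩
          rw [Real.norm_eq_abs] at this
          exact (abs_sub _ _).trans (by linarith)
      rwa [abs_of_pos (sub_pos.2 huv)] at this
    have e2 : |intervalMean g c v - intervalMean g c u| * (u - c) ≤ 2 * M * (v - u) := by
      have e3 : |intervalMean g c v - intervalMean g c u| * (v - c) ≤ 2 * M * (v - u) := by
        rw [intervalMean_sub_intervalMean hcu.ne hcv.ne (h.intervalIntegrable hcI huI)
          (h.intervalIntegrable huI hvI), abs_div, abs_of_pos (sub_pos.2 hcv),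
          div_mul_cancel₀ _ (sub_pos.2 hcv).ne']
        have := intervalIntegral.norm_integral_le_of_norm_le_const (a := u) (b := v)
          (f := fun t => g t - intervalMean g c u) (C := 2 * M) fun t ht => by
            rw [uIoc_of_le huv.le] at ht
            have := hM t ⟨hcu.le.trans ht.1.le, ht.2.trans hv⟩
            rw [Real.norm_eq_abs] at this ⊢
            exact (abs_sub _ _).trans (by linarith)
        rwa [abs_of_pos (sub_pos.2 huv)] at this
      exact (mul_le_mul_of_nonneg_left (by linarith) (abs_nonneg _)).trans e3
    have e4 := (abs_le.1 (abs_integral_abs_sub_sub_le (intervalMean g c u) (intervalMean g c v)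
      (h.intervalIntegrable hcI huI) (h.intervalIntegrable huI hvI))).2
    rw [integral_abs_sub_mean hcu.ne, integral_abs_sub_mean hcv.ne,
      abs_of_pos (sub_pos.2 hcu)] at e4
    have e5 := h.add c u v hac hcu huv hvI.2
    have e6 := (abs_le.1 (h.low u v huI.1 huv hvI.2)).2
    have e7 := meanOsc_nonneg (f := g) huv.le
    have e8 := meanOsc_nonneg (f := g) hcv.le
    have e9 : meanOsc g u v * (x - c) ≤ 4 * M * (v - u) := by
      have : meanOsc g u v * (u - c) ≤ 4 * M * (v - u) := by
        have : meanOsc g c v * (u - c) ≤ meanOsc g c v * (v - c) :=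
          mul_le_mul_of_nonneg_left (by linarith) e8
        rw [e5] at this e4
        linarith
      exact (mul_le_mul_of_nonneg_left (by linarith) e7).trans this
    have e10 : meanOsc g u v ≤ 4 * M * (v - u) / (x - c) := by
      rwa [le_div_iff₀ (sub_pos.2 hcx)]
    have : 16 * M / (x - c) * (v - u) = 4 * (4 * M * (v - u) / (x - c)) := by ring
    linarith
  have hK0 : 0 ≤ 16 * M / (x - c) := div_nonneg (by positivity) (by linarith)
  refine ⟨⟨16 * M / (x - c), hK0⟩, LipschitzOnWith.of_le_add_mul _ fun v hv u hu => ?_⟩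
  simp only [Real.dist_eq]
  rcases lt_or_ge u v with huv | huv
  · rw [abs_of_pos (sub_pos.2 huv)]
    exact key u v hu.1 huv hv.2
  · have := hmono (hI v ⟨hcx.le.trans hv.1, hv.2⟩) (hI u ⟨hcx.le.trans hu.1, hu.2⟩) huv
    exact this.trans (le_add_of_nonneg_right (mul_nonneg hK0 (abs_nonneg (v - u))))

lemma four_mul_meanOsc (h : HasQuarterOsc g a b) (hmono : MonotoneOn g (Ioo a b)) {x y : ℝ}
    (hx : a < x) (hxy : x < y) (hy : y < b) : 4 * meanOsc g x y = g y - g x := by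
  have hI : ∀ t ∈ Icc x y, t ∈ Ioo a b := fun t ht => ⟨hx.trans_le ht.1, ht.2.trans_lt hy⟩
  obtain ⟨K, hK⟩ := h.exists_lipschitzOnWith hmono hx hxy hy
  have h1 := h.up x y K hx hxy hy hK (Or.inl (hmono.mono hI))
  have h2 := h.low x y hx hxy hy
  rw [abs_of_nonneg (sub_nonneg.2 (hmono (hI x ⟨le_rfl, hxy.le⟩) (hI y ⟨hxy.le, le_rfl⟩) hxy.le))]
    at h1 h2
  exact le_antisymm h1 h2

lemma ae_ne_of_strictMonoOn (hg : StrictMonoOn g (Ioo a b)) {c d : ℝ} (hc : c ∈ Ioo a b)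
    (hd : d ∈ Ioo a b) (m : ℝ) : ∀ᵐ x, x ∈ uIoc c d → g x ≠ m := by
  have hsub : {x | ¬(x ∈ uIoc c d → g x ≠ m)}.Subsingleton := by
    intro x hx y hy
    simp only [mem_ofPred_eq, Classical.not_imp, not_not] at hx hy
    have hI := (convex_Ioo a b).ordConnected.uIcc_subset hc hd
    exact hg.injOn (hI (uIoc_subset_uIcc hx.1)) (hI (uIoc_subset_uIcc hy.1))
      (hx.2.trans hy.2.symm)
  exact hsub.measure_zero _

lemma intervalMean_mem_Ioo (h : HasQuarterOsc g a b) (hg : StrictMonoOn g (Ioo a b)) {c d : ℝ}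
    (hc : a < c) (hcd : c < d) (hd : d < b) : intervalMean g c d ∈ Ioo (g c) (g d) := by
  have hI : ∀ t ∈ Icc c d, t ∈ Ioo a b := fun t ht => ⟨hc.trans_le ht.1, ht.2.trans_lt hd⟩
  have hcI := hI c ⟨le_rfl, hcd.le⟩
  have hdI := hI d ⟨hcd.le, le_rfl⟩
  have hcont : ContinuousOn g (Icc c d) := h.cont.mono hI
  have hpos : 0 < d - c := sub_pos.2 hcd
  unfold intervalMean
  constructor
  · rw [lt_div_iff₀ hpos]
    have := intervalIntegral.integral_lt_integral_of_continuousOn_of_le_of_exists_lt hcd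
      (continuousOn_const (c := g c)) hcont
      (fun x hx => hg.monotoneOn hcI (hI x ⟨hx.1.le, hx.2⟩) hx.1.le)
      ⟨d, ⟨hcd.le, le_rfl⟩, hg hcI hdI hcd⟩
    simpa [mul_comm] using this
  · rw [div_lt_iff₀ hpos]
    have := intervalIntegral.integral_lt_integral_of_continuousOn_of_le_of_exists_lt hcd
      hcont (continuousOn_const (c := g d))
      (fun x hx => hg.monotoneOn (hI x ⟨hx.1.le, hx.2⟩) hdI hx.2)
      ⟨c, ⟨le_rfl, hcd.le⟩, hg hcI hdI hcd⟩
    simpa [mul_comm] using this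

/-- Both end point derivatives of `4 osc(g, (c, d)) = g d - g c`. -/
lemma hasDerivAt_endpoints (h : HasQuarterOsc g a b) (hg : StrictMonoOn g (Ioo a b)) {c d : ℝ}
    (hc : a < c) (hcd : c < d) (hd : d < b) :
    HasDerivAt g ((4 * (g d - intervalMean g c d) * (1 - signMean g c d) - (g d - g c)) / (d - c))
      d ∧
    HasDerivAt g ((4 * (intervalMean g c d - g c) * (1 + signMean g c d) - (g d - g c)) / (d - c))
      c := by
  have hcI : c ∈ Ioo a b := ⟨hc, hcd.trans hd⟩
  have hdI : d ∈ Ioo a b := ⟨hc.trans hcd, hd⟩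
  obtain ⟨m1, m2⟩ := h.intervalMean_mem_Ioo hg hc hcd hd
  have hW := h.four_mul_meanOsc hg.monotoneOn hc hcd hd
  constructor
  · have h1 := ((h.hasDerivAt_meanOsc hcI hdI hcd.ne
      (ae_ne_of_strictMonoOn hg hcI hdI _)).const_mul 4).const_add (g c)
    refine (h1.congr_of_eventuallyEq (f₁ := g) ?_).congr_deriv ?_
    · filter_upwards [Ioo_mem_nhds hcd hd] with e he
      rw [h.four_mul_meanOsc hg.monotoneOn hc he.1 he.2]
      ring
    · rw [abs_of_pos (sub_pos.2 m2), ← hW]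
      ring
  · have h1 := ((h.hasDerivAt_meanOsc hdI hcI hcd.ne'
      (ae_ne_of_strictMonoOn hg hdI hcI _)).const_mul 4).const_sub (g d)
    refine (h1.congr_of_eventuallyEq (f₁ := g) ?_).congr_deriv ?_
    · filter_upwards [Ioo_mem_nhds hc hcd] with e he
      rw [meanOsc_symm, h.four_mul_meanOsc hg.monotoneOn he.1 he.2 hd]
      ring
    · rw [intervalMean_symm g d c, meanOsc_symm g d c, signMean_symm g d c,
        abs_of_neg (sub_neg.2 m1), ← hW, ← neg_sub d c, div_neg]
      ring

/-- Eliminating `signMean` from `hasDerivAt_endpoints` leaves a relation between `g` and its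
derivative at the two end points and the mean of `g`. -/
lemma deriv_relation (h : HasQuarterOsc g a b) (hg : StrictMonoOn g (Ioo a b)) {c d : ℝ}
    (hc : a < c) (hcd : c < d) (hd : d < b) :
    (d - c) * (deriv g d * (intervalMean g c d - g c) + deriv g c * (g d - intervalMean g c d))
      = 8 * (g d - intervalMean g c d) * (intervalMean g c d - g c) - (g d - g c) ^ 2 := by
  obtain ⟨h1, h2⟩ := h.hasDerivAt_endpoints hg hc hcd hd
  rw [h1.deriv, h2.deriv]
  have : d - c ≠ 0 := (sub_pos.2 hcd).ne'
  field_simp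
  ring

/-! ### Smoothness -/

lemma differentiableOn (h : HasQuarterOsc g a b) (hg : StrictMonoOn g (Ioo a b)) :
    DifferentiableOn ℝ g (Ioo a b) := fun x hx => by
  obtain ⟨c, hc, hcx⟩ := exists_between hx.1
  exact (h.hasDerivAt_endpoints hg hc hcx hx.2).1.differentiableAt.differentiableWithinAt

/-- With `c` fixed, `deriv_relation` expresses `deriv g` through `g` and a primitive of `g`, so
that `g` gains one derivative at a time. -/
lemma contDiffOn (h : HasQuarterOsc g a b) (hg : StrictMonoOn g (Ioo a b)) (n : ℕ) :
    ContDiffOn ℝ n g (Ioo a b) := by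
  induction n with
  | zero => exact contDiffOn_zero.2 h.cont
  | succ n ih =>
    rw [Nat.cast_succ, contDiffOn_succ_iff_deriv_of_isOpen isOpen_Ioo]
    refine ⟨h.differentiableOn hg, by simp, fun d hd => ContDiffAt.contDiffWithinAt ?_⟩
    obtain ⟨c, hc, hcd⟩ := exists_between hd.1
    obtain ⟨G, hG, hGi⟩ := h.exists_primitive
    have hcI : c ∈ Ioo a b := ⟨hc, hcd.trans hd.2⟩
    have hgd : ContDiffAt ℝ n g d := ih.contDiffAt (isOpen_Ioo.mem_nhds hd)
    have hGd : ContDiffAt ℝ n G d := by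
      have : ContDiffOn ℝ (n + 1) G (Ioo a b) := by
        rw [contDiffOn_succ_iff_deriv_of_isOpen isOpen_Ioo]
        exact ⟨fun x hx => (hG x hx).differentiableAt.differentiableWithinAt, by simp,
          ih.congr fun x hx => (hG x hx).deriv⟩
      exact (this.contDiffAt (isOpen_Ioo.mem_nhds hd)).of_le (by simp)
    have hmd : ContDiffAt ℝ n (intervalMean g c) d := by
      have : ContDiffAt ℝ n (fun e => (G e - G c) / (e - c)) d :=
        (hGd.sub contDiffAt_const).div (contDiffAt_id.sub contDiffAt_const)
          (sub_pos.2 hcd).ne'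
      refine this.congr_of_eventuallyEq ?_
      filter_upwards [isOpen_Ioo.mem_nhds hd] with e he
      rw [intervalMean, hGi c hcI e he]
    have hB := (h.intervalMean_mem_Ioo hg hc hcd hd.2).1
    have hform : ContDiffAt ℝ n (fun e => (8 * (g e - intervalMean g c e) *
        (intervalMean g c e - g c) - (g e - g c) ^ 2 -
        (e - c) * (deriv g c * (g e - intervalMean g c e))) /
        ((e - c) * (intervalMean g c e - g c))) d := by
      have hid : ContDiffAt ℝ n (fun e : ℝ => e - c) d := contDiffAt_id.sub contDiffAt_const
      refine ContDiffAt.div ?_ (hid.mul (hmd.sub contDiffAt_const))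
        (mul_pos (sub_pos.2 hcd) (sub_pos.2 hB)).ne'
      exact (((contDiffAt_const.mul (hgd.sub hmd)).mul (hmd.sub contDiffAt_const)).sub
        ((hgd.sub contDiffAt_const).pow 2)).sub (hid.mul (contDiffAt_const.mul (hgd.sub hmd)))
    refine hform.congr_of_eventuallyEq ?_
    filter_upwards [Ioo_mem_nhds hcd hd.2] with e he
    have hBe := (h.intervalMean_mem_Ioo hg hc he.1 he.2).1
    rw [eq_div_iff (mul_pos (sub_pos.2 he.1) (sub_pos.2 hBe)).ne']
    linarith [h.deriv_relation hg hc he.1 he.2]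

end HasQuarterOsc

/-! ### Taylor expansion of the end point relation -/

/-- Taylor's theorem with Peano remainder for a sequence of functions each of which is the
derivative of its predecessor. -/
lemma isLittleO_taylor_of_hasDerivAt {F : ℕ → ℝ → ℝ} {a b c : ℝ} (hc : c ∈ Ioo a b)
    (hF : ∀ k, ∀ x ∈ Ioo a b, HasDerivAt (F k) (F (k + 1) x) x) (n : ℕ) (j : ℕ) :
    (fun x => F j x - ∑ i ∈ Finset.range (n + 1), F (j + i) c / i.factorial * (x - c) ^ i)
      =o[𝓝 c] fun x => (x - c) ^ n := by
  induction n generalizing j with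
  | zero =>
    simpa using (Asymptotics.isLittleO_one_iff ℝ).2
      (tendsto_sub_nhds_zero_iff.2 (hF j c hc).continuousAt.tendsto)
  | succ n ih =>
    set u : ℝ → ℝ := fun x => F j x -
      ∑ i ∈ Finset.range (n + 1 + 1), F (j + i) c / i.factorial * (x - c) ^ i with hu
    have hder : ∀ z ∈ Ioo a b, HasDerivAt u (F (j + 1) z -
        ∑ i ∈ Finset.range (n + 1), F (j + 1 + i) c / i.factorial * (z - c) ^ i) z := by
      intro z hz
      refine (hF j z hz).sub ?_
      simp only [Finset.sum_range_succ' _ (n + 1)]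
      have : ∀ i ∈ Finset.range (n + 1), HasDerivAt
          (fun x => F (j + (i + 1)) c / (i + 1).factorial * (x - c) ^ (i + 1))
          (F (j + 1 + i) c / i.factorial * (z - c) ^ i) z := by
        intro i _
        refine (((hasDerivAt_id z).sub_const c).pow (i + 1)).const_mul _ |>.congr_deriv ?_
        rw [Nat.factorial_succ, show j + (i + 1) = j + 1 + i by ring]
        have : (i.factorial : ℝ) ≠ 0 := by positivity
        have : ((i : ℝ) + 1) ≠ 0 := by positivity
        simp
        field_simp
      simpa using (HasDerivAt.fun_sum this).add_const (F j c)
    have hu0 : u c = 0 := by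
      simp [hu, Finset.sum_range_succ']
    have := (convex_Ioo a b).isLittleO_pow_succ_real hc
      (fun z hz => (hder z hz).hasDerivWithinAt) ((ih (j + 1)).mono nhdsWithin_le_nhds)
    simpa only [hu0, sub_zero, nhdsWithin_eq_nhds.2 (isOpen_Ioo.mem_nhds hc)] using this

lemma exists_taylor_of_hasDerivAt {F : ℕ → ℝ → ℝ} {a b c : ℝ} (hc : c ∈ Ioo a b)
    (hF : ∀ k, ∀ x ∈ Ioo a b, HasDerivAt (F k) (F (k + 1) x) x) (n : ℕ) (j : ℕ) :
    ∃ e : ℝ → ℝ, Tendsto e (𝓝[>] c) (𝓝 0) ∧ ∀ x, c < x → F j x =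
      (∑ i ∈ Finset.range (n + 1), F (j + i) c / i.factorial * (x - c) ^ i)
        + e x * (x - c) ^ n := by
  refine ⟨_, ((isLittleO_taylor_of_hasDerivAt hc hF n j).tendsto_div_nhds_zero).mono_left
    nhdsWithin_le_nhds, fun x hx => ?_⟩
  rw [div_mul_cancel₀ _ (pow_ne_zero n (sub_pos.2 hx).ne')]
  ring

/-- The relation of `HasQuarterOsc.deriv_relation`, expanded at `c` to relative order four, forces
the third function of the sequence (a second derivative) to vanish. The coefficient of
order two gives `3 q t = r ^ 2`, where `q`, `r`, `t`, … are the successive derivatives starting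
with the first one; this alone has the solutions `q = (α x + β) ^ (3 / 2)`, which the coefficient
of order four excludes. -/
lemma second_deriv_eq_zero_of_relation {F : ℕ → ℝ → ℝ} {a b : ℝ}
    (hF : ∀ k, ∀ x ∈ Ioo a b, HasDerivAt (F k) (F (k + 1) x) x)
    (hrel : ∀ c d m, a < c → c < d → d < b → m = (F 0 d - F 0 c) / (d - c) →
      (d - c) * (F 2 d * (m - F 1 c) + F 2 c * (F 1 d - m))
        = 8 * (F 1 d - m) * (m - F 1 c) - (F 1 d - F 1 c) ^ 2)
    {x : ℝ} (hx : x ∈ Ioo a b) : F 3 x = 0 := by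
  have expand : ∀ c ∈ Ioo a b, 3 * F 2 c * F 4 c = F 3 c ^ 2 ∧
      (F 3 c * F 4 c + 3 * F 2 c * F 5 c = 0 →
        F 2 c * F 6 c / 80 + F 3 c * F 5 c / 90 + F 4 c ^ 2 / 144 = 0) := by
    intro c hc
    obtain ⟨q, hq⟩ : ∃ q, F 2 c = q := ⟨_, rfl⟩
    obtain ⟨r, hr⟩ : ∃ r, F 3 c = r := ⟨_, rfl⟩
    obtain ⟨t, ht⟩ : ∃ t, F 4 c = t := ⟨_, rfl⟩
    obtain ⟨v, hv⟩ : ∃ v, F 5 c = v := ⟨_, rfl⟩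
    obtain ⟨w, hw⟩ : ∃ w, F 6 c = w := ⟨_, rfl⟩
    obtain ⟨e2, t2, f2⟩ := exists_taylor_of_hasDerivAt hc hF 4 2
    obtain ⟨e1, t1, f1⟩ := exists_taylor_of_hasDerivAt hc hF 5 1
    obtain ⟨e0, t0, f0⟩ := exists_taylor_of_hasDerivAt hc hF 6 0
    simp only [Finset.sum_range_succ, Finset.sum_range_zero, Nat.factorial, Nat.reduceAdd, hq, hr,
      ht, hv, hw] at f0 f1 f2
    have hy : Tendsto (fun x => x - c) (𝓝[>] c) (𝓝 0) := by
      have : ContinuousAt (fun x => x - c) c := by fun_prop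
      simpa [ContinuousAt] using this.tendsto.mono_left (nhdsWithin_le_nhds (s := Ioi c))
    -- the terms of relative order at least four, as a function of `x - c` and the remainders
    set Φ : ℝ × ℝ × ℝ × ℝ → ℝ := fun z =>
      let y := z.1
      let p4 := w / 24 + z.2.1
      let a4 := w / 144 + (z.2.2.1 - z.2.2.2)
      let b4 := w / 720 + z.2.2.2
      let P3 := q + r * y + t / 2 * y ^ 2 + v / 6 * y ^ 3
      let A3 := q / 2 + r / 3 * y + t / 8 * y ^ 2 + v / 30 * y ^ 3
      let B3 := q / 2 + r / 6 * y + t / 24 * y ^ 2 + v / 120 * y ^ 3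
      (r * v / 90 + t ^ 2 / 144) + t * v / 180 * y + 13 * v ^ 2 / 14400 * y ^ 2 +
        (p4 * (B3 + y ^ 4 * b4) + P3 * b4 + q * a4 - 6 * (a4 * (B3 + y ^ 4 * b4) + A3 * b4) +
          a4 * (2 * A3 + y ^ 4 * a4) + b4 * (2 * B3 + y ^ 4 * b4)) with hΦ
    have hΦc : Continuous Φ := by
      simp only [hΦ]
      fun_prop
    have hΦ0 : Φ (0, 0, 0, 0) = q * w / 80 + r * v / 90 + t ^ 2 / 144 := by
      simp only [hΦ]
      ring
    have hlim : Tendsto (fun x => Φ (x - c, e2 x, e1 x, e0 x)) (𝓝[>] c)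
        (𝓝 (q * w / 80 + r * v / 90 + t ^ 2 / 144)) := by
      rw [← hΦ0]
      exact (hΦc.tendsto _).comp (hy.prodMk_nhds (t2.prodMk_nhds (t1.prodMk_nhds t0)))
    have heq : ∀ᶠ x in 𝓝[>] c, (3 * q * t - r ^ 2) / 36 + (r * t + 3 * q * v) / 72 * (x - c)
        + (x - c) ^ 2 * Φ (x - c, e2 x, e1 x, e0 x) = 0 := by
      filter_upwards [Ioo_mem_nhdsGT hc.2] with x hx
      have hrel' := hrel c x _ hc.1 hx.1 hx.2 rfl
      have hxc : x - c ≠ 0 := (sub_pos.2 hx.1).ne'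
      obtain ⟨y, hyd⟩ : ∃ y, x - c = y := ⟨_, rfl⟩
      have g0 : F 0 x - F 0 c = F 1 c * y + y ^ 2 * (q / 2 + r / 6 * y + t / 24 * y ^ 2 +
          v / 120 * y ^ 3 + (w / 720 + e0 x) * y ^ 4) := by
        rw [f0 x hx.1, hyd]
        push_cast
        ring
      have g1 : F 1 x = F 1 c + y * (q + r / 2 * y + t / 6 * y ^ 2 + v / 24 * y ^ 3 +
          (w / 120 + e1 x) * y ^ 4) := by
        rw [f1 x hx.1, hyd]
        push_cast
        ring
      have g2 : F 2 x = q + r * y + t / 2 * y ^ 2 + v / 6 * y ^ 3 +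
          (w / 24 + e2 x) * y ^ 4 := by
        rw [f2 x hx.1, hyd]
        push_cast
        ring
      rw [g0, g1, g2, hq, hyd] at hrel'
      rw [hyd] at hxc ⊢
      have hm : (F 1 c * y + y ^ 2 * (q / 2 + r / 6 * y + t / 24 * y ^ 2 +
          v / 120 * y ^ 3 + (w / 720 + e0 x) * y ^ 4)) / y = F 1 c + y * (q / 2 + r / 6 * y +
          t / 24 * y ^ 2 + v / 120 * y ^ 3 + (w / 720 + e0 x) * y ^ 4) := by
        field_simp
      rw [hm] at hrel'
      have hy4 : y ^ 4 ≠ 0 := pow_ne_zero 4 hxc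
      refine (mul_eq_zero.1 (?_ : y ^ 4 * _ = 0)).resolve_left hy4
      simp only [hΦ]
      linear_combination hrel'
    have hl2 : (3 * q * t - r ^ 2) / 36 = 0 := by
      have h1 := ((hy.const_mul ((r * t + 3 * q * v) / 72)).const_add
        ((3 * q * t - r ^ 2) / 36)).add ((hy.pow 2).mul hlim)
      have h2 := tendsto_nhds_unique (h1.congr' heq) tendsto_const_nhds
      simpa using h2
    refine ⟨by rw [hq, hr, ht]; linarith, fun h3 => ?_⟩
    rw [hq, hr, ht, hv] at h3
    rw [hq, hr, ht, hv, hw]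
    refine tendsto_nhds_unique (hlim.congr' ?_) tendsto_const_nhds
    filter_upwards [heq, self_mem_nhdsWithin] with x hx hxc
    rw [hl2, h3] at hx
    have : x - c ≠ 0 := (sub_pos.2 hxc).ne'
    simpa [this] using hx
  -- the second order relation holds identically, so it may be differentiated twice
  have d1 : ∀ z ∈ Ioo a b, F 3 z * F 4 z + 3 * F 2 z * F 5 z = 0 := by
    intro z hz
    have h1 : HasDerivAt (fun s => 3 * F 2 s * F 4 s - F 3 s ^ 2) _ z :=
      (((hF 2 z hz).const_mul 3).mul (hF 4 z hz)).sub ((hF 3 z hz).pow 2)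
    have h2 : HasDerivAt (fun s => 3 * F 2 s * F 4 s - F 3 s ^ 2) 0 z := by
      refine (hasDerivAt_const z (0 : ℝ)).congr_of_eventuallyEq ?_
      filter_upwards [isOpen_Ioo.mem_nhds hz] with s hs
      rw [(expand s hs).1, sub_self]
    have := h1.unique h2
    norm_num at this
    linarith
  have d2 : F 4 x ^ 2 + 4 * F 3 x * F 5 x + 3 * F 2 x * F 6 x = 0 := by
    have h1 : HasDerivAt (fun s => F 3 s * F 4 s + 3 * F 2 s * F 5 s) _ x :=
      ((hF 3 x hx).mul (hF 4 x hx)).add (((hF 2 x hx).const_mul 3).mul (hF 5 x hx))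
    have h2 : HasDerivAt (fun s => F 3 s * F 4 s + 3 * F 2 s * F 5 s) 0 x := by
      refine (hasDerivAt_const x (0 : ℝ)).congr_of_eventuallyEq ?_
      filter_upwards [isOpen_Ioo.mem_nhds hx] with s hs
      rw [d1 s hs]
    have := h1.unique h2
    norm_num at this
    linarith
  obtain ⟨h1, h2⟩ := expand x hx
  have h3 := h2 (d1 x hx)
  have h4 := d1 x hx
  have h5 : F 4 x ^ 2 = 2 * F 3 x * F 5 x := by linear_combination 360 * h3 - 3 / 2 * d2
  have : F 3 x ^ 4 = 0 := by
    linear_combination 3 * F 2 x ^ 2 * h5 - (3 * F 2 x * F 4 x + 3 * F 3 x ^ 2) / 3 * h1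
      + 2 * F 2 x * F 3 x * h4
  exact pow_eq_zero_iff (by norm_num) |>.1 this

/-! ### Continuous functions with additive mean oscillation are affine -/

namespace HasQuarterOsc

variable {g : ℝ → ℝ} {a b : ℝ}

lemma hasDerivAt_iteratedDeriv (h : HasQuarterOsc g a b) (hg : StrictMonoOn g (Ioo a b)) (k : ℕ)
    {x : ℝ} (hx : x ∈ Ioo a b) :
    HasDerivAt (iteratedDeriv k g) (iteratedDeriv (k + 1) g x) x := by
  have key : ∀ k n : ℕ, ContDiffOn ℝ n (iteratedDeriv k g) (Ioo a b) := by
    intro k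
    induction k with
    | zero => exact fun n => by simpa using h.contDiffOn hg n
    | succ k ih =>
      intro n
      have := ih (n + 1)
      rw [Nat.cast_succ, contDiffOn_succ_iff_deriv_of_isOpen isOpen_Ioo] at this
      rw [iteratedDeriv_succ]
      exact this.2.2
  rw [iteratedDeriv_succ]
  exact ((key k 1).differentiableOn (by simp) |>.differentiableAt
    (isOpen_Ioo.mem_nhds hx)).hasDerivAt

lemma affine_of_strictMonoOn (h : HasQuarterOsc g a b) (hg : StrictMonoOn g (Ioo a b)) :
    ∃ α β : ℝ, ∀ x ∈ Ioo a b, g x = α * x + β := by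
  obtain ⟨G, hG, hGi⟩ := h.exists_primitive
  -- a primitive of `g`, then `g` and its successive derivatives
  set F : ℕ → ℝ → ℝ := fun k => Nat.casesOn k G fun j => iteratedDeriv j g
  have F0 : F 0 = G := rfl
  have F1 : F 1 = g := iteratedDeriv_zero
  have F2 : F 2 = deriv g := iteratedDeriv_one
  have hF : ∀ k, ∀ x ∈ Ioo a b, HasDerivAt (F k) (F (k + 1) x) x := by
    rintro (_ | k) x hx
    · simpa only [F0, F1] using hG x hx
    · exact h.hasDerivAt_iteratedDeriv hg k hx
  have h2 : ∀ x ∈ Ioo a b, F 3 x = 0 := fun x hx => by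
    refine second_deriv_eq_zero_of_relation hF (fun c d m hc hcd hd hm => ?_) hx
    have hm' : m = intervalMean g c d := by
      rw [hm, F0, intervalMean, hGi c ⟨hc, hcd.trans hd⟩ d ⟨hc.trans hcd, hd⟩]
    rw [hm']
    rw [F1, F2]
    exact h.deriv_relation hg hc hcd hd
  rcases (Ioo a b).eq_empty_or_nonempty with he | ⟨x₀, hx₀⟩
  · exact ⟨0, 0, by simp [he]⟩
  have hconst : ∀ x ∈ Ioo a b, F 2 x = F 2 x₀ := fun x hx =>
    isOpen_Ioo.is_const_of_deriv_eq_zero isPreconnected_Ioo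
      (fun z hz => (hF 2 z hz).differentiableAt.differentiableWithinAt)
      (fun z hz => (hF 2 z hz).deriv.trans (h2 z hz)) hx hx₀
  have hlin : ∀ z ∈ Ioo a b, HasDerivAt (fun x => g x - F 2 x₀ * x) 0 z := fun z hz => by
    have h1 : HasDerivAt g (F 2 z) z := F1 ▸ hF 1 z hz
    refine (h1.sub ((hasDerivAt_id z).const_mul (F 2 x₀))).congr_deriv ?_
    rw [hconst z hz]
    ring
  refine ⟨F 2 x₀, g x₀ - F 2 x₀ * x₀, fun x hx => ?_⟩
  have := isOpen_Ioo.is_const_of_deriv_eq_zero isPreconnected_Ioo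
      (fun z hz => (hlin z hz).differentiableAt.differentiableWithinAt)
      (fun z hz => by rw [(hlin z hz).deriv, Pi.zero_apply]) hx hx₀
  linarith

theorem affine (h : HasQuarterOsc g a b) : ∃ α β : ℝ, ∀ x ∈ Ioo a b, g x = α * x + β := by
  by_cases hT : ∃ c d, a < c ∧ c < d ∧ d < b ∧ 0 < meanOsc g c d
  · obtain ⟨c, d, hc, hcd, hd, hW⟩ := hT
    have hne : g d - intervalMean g c d ≠ 0 := fun h0 =>
      hW.ne' (h.meanOsc_eq_zero_of_right hc hcd hd (sub_eq_zero.1 h0))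
    -- the sign at one interval of positive mean oscillation decides between `g` and `-g`
    rcases lt_or_gt_of_ne hne with hs | hs
    · have hn := h.neg
      have hW' : 0 < meanOsc (fun x => -g x) c d := by rwa [meanOsc_neg]
      have hmono := hn.monotoneOn fun c' d' h1 h2 h3 h4 =>
        hn.sign_const hc hcd hd hW' h1 h2 h3 h4 (by rw [intervalMean_neg]; linarith)
      obtain ⟨α, β, hαβ⟩ := hn.affine_of_strictMonoOn (hn.strictMonoOn hmono hc hcd hd hW')
      exact ⟨-α, -β, fun x hx => by linarith [hαβ x hx]⟩
    · have hmono := h.monotoneOn fun c' d' h1 h2 h3 h4 =>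
        h.sign_const hc hcd hd hW h1 h2 h3 h4 hs
      exact h.affine_of_strictMonoOn (h.strictMonoOn hmono hc hcd hd hW)
  · push Not at hT
    rcases (Ioo a b).eq_empty_or_nonempty with he | ⟨x₀, hx₀⟩
    · exact ⟨0, 0, by simp [he]⟩
    have key : ∀ x y, a < x → x < y → y < b → g x = g y := fun x y h1 h2 h3 => by
      have h4 := h.low x y h1 h2 h3
      have h5 := hT x y h1 h2 h3
      exact (sub_eq_zero.1 (abs_nonpos_iff.1 (by linarith))).symm
    refine ⟨0, g x₀, fun x hx => ?_⟩
    rw [zero_mul, zero_add]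
    rcases lt_trichotomy x x₀ with hlt | rfl | hlt
    · exact key x x₀ hx.1 hlt hx₀.2
    · rfl
    · exact (key x₀ x hx₀.1 hlt hx.2).symm

end HasQuarterOsc

/-! ### The total variation as a set function -/

namespace IsUnitTestFunction

variable {I J : Set ℝ} {φ ψ : ℝ → ℝ}

lemma mono (h : IsUnitTestFunction I φ) (hIJ : I ⊆ J) : IsUnitTestFunction J φ :=
  ⟨h.1, h.2, h.3.trans hIJ, h.4⟩

lemma zero (I : Set ℝ) : IsUnitTestFunction I fun _ => 0 where
  contDiff := contDiff_const
  hasCompactSupport := HasCompactSupport.zero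
  tsupport_subset := by simp [tsupport]
  abs_le_one := by simp

lemma neg (h : IsUnitTestFunction I φ) : IsUnitTestFunction I fun x => -φ x where
  contDiff := h.contDiff.neg
  hasCompactSupport := h.hasCompactSupport.neg
  tsupport_subset := by simpa [tsupport, Function.support_fun_neg] using h.tsupport_subset
  abs_le_one x := by simpa using h.abs_le_one x

/-- The sum of two test functions on disjoint intervals is a test function. -/
lemma add (hφ : IsUnitTestFunction I φ) (hψ : IsUnitTestFunction J ψ) (hIJ : Disjoint I J) :
    IsUnitTestFunction (I ∪ J) fun x => φ x + ψ x where
  contDiff := hφ.contDiff.add hψ.contDiff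
  hasCompactSupport := hφ.hasCompactSupport.add hψ.hasCompactSupport
  tsupport_subset :=
    (tsupport_add φ ψ).trans (union_subset_union hφ.tsupport_subset hψ.tsupport_subset)
  abs_le_one x := by
    by_cases hx : x ∈ I
    · have : ψ x = 0 := image_eq_zero_of_notMem_tsupport fun h =>
        disjoint_left.1 hIJ hx (hψ.tsupport_subset h)
      simpa [this] using hφ.abs_le_one x
    · have : φ x = 0 := image_eq_zero_of_notMem_tsupport fun h => hx (hφ.tsupport_subset h)
      simpa [this] using hψ.abs_le_one x

lemma mul {χ : ℝ → ℝ} (hφ : IsUnitTestFunction I φ) (hχ : ContDiff ℝ ∞ χ)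
    (hχ1 : ∀ x, |χ x| ≤ 1) (hJ : tsupport φ ∩ tsupport χ ⊆ J) :
    IsUnitTestFunction J fun x => φ x * χ x where
  contDiff := hφ.contDiff.mul hχ
  hasCompactSupport := hφ.hasCompactSupport.mul_right
  tsupport_subset :=
    (subset_inter tsupport_mul_subset_left tsupport_mul_subset_right).trans hJ
  abs_le_one x := by
    rw [abs_mul]
    exact mul_le_one₀ (hφ.abs_le_one x) (abs_nonneg _) (hχ1 x)

lemma differentiable (h : IsUnitTestFunction I φ) : Differentiable ℝ φ :=
  h.contDiff.differentiable (by simp)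

lemma integrable_mul_deriv (h : IsUnitTestFunction I φ) {f : ℝ → ℝ} (hf : Integrable f) :
    Integrable fun x => f x * deriv φ x :=
  hf.locallyIntegrable.integrable_smul_right_of_hasCompactSupport
    (h.contDiff.continuous_deriv (by simp)) h.hasCompactSupport.deriv

lemma setIntegral_eq (h : IsUnitTestFunction I φ) (f : ℝ → ℝ) :
    ∫ x in I, f x * deriv φ x = ∫ x, f x * deriv φ x := by
  refine setIntegral_eq_integral_of_forall_compl_eq_zero fun x hx => ?_
  rw [image_eq_zero_of_notMem_tsupport (fun hx' => hx (h.tsupport_subset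
    (tsupport_deriv_subset hx'))), mul_zero]

end IsUnitTestFunction

/-- The hypothesis `osc(f, I) = |Df|(I) / 4` for the open intervals `I ⊆ (a, b)`, stated for an
integrable function on the line and in terms of real numbers: `4 osc(f, (c, d))` is the least upper
bound of the integrals that define the total variation. -/
structure HasQuarterVariation (f : ℝ → ℝ) (a b : ℝ) : Prop where
  integrable : Integrable f
  integral_le : ∀ {c d φ}, a ≤ c → c < d → d ≤ b → IsUnitTestFunction (Ioo c d) φ →
    ∫ x, f x * deriv φ x ≤ 4 * meanOsc f c d
  le_of_forall : ∀ {c d K}, a ≤ c → c < d → d ≤ b →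
    (∀ φ, IsUnitTestFunction (Ioo c d) φ → ∫ x, f x * deriv φ x ≤ K) → 4 * meanOsc f c d ≤ K

lemma HasQuarterVariation.of_osc_eq {f : ℝ → ℝ} {a b : ℝ} (hf : Integrable f)
    (hosc : ∀ c d : ℝ, a ≤ c → c < d → d ≤ b →
      ENNReal.ofReal (osc f (Ioo c d)) = 1 / 4 * totalVariation f (Ioo c d)) :
    HasQuarterVariation f a b := by
  have key : ∀ c d, a ≤ c → c < d → d ≤ b →
      totalVariation f (Ioo c d) = ENNReal.ofReal (4 * meanOsc f c d) := by
    intro c d hc hcd hd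
    rw [ENNReal.ofReal_mul (by norm_num), ← osc_Ioo_eq_meanOsc f hcd, hosc c d hc hcd hd,
      ← mul_assoc]
    have : ENNReal.ofReal 4 * (1 / 4) = 1 := by
      rw [one_div, show ENNReal.ofReal 4 = 4 by simp]
      exact ENNReal.mul_inv_cancel (by norm_num) (by norm_num)
    rw [this, one_mul]
  refine ⟨hf, fun {c d φ} hc hcd hd hφ => ?_, fun {c d K} hc hcd hd hK => ?_⟩
  · rw [← ENNReal.ofReal_le_ofReal_iff (mul_nonneg (by norm_num) (meanOsc_nonneg hcd.le)),
      ← key c d hc hcd hd, ← hφ.setIntegral_eq]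
    exact le_iSup₂_of_le φ hφ le_rfl
  · have hK0 : 0 ≤ K := by simpa using hK _ (IsUnitTestFunction.zero _)
    rw [← ENNReal.ofReal_le_ofReal_iff hK0, ← key c d hc hcd hd]
    refine iSup₂_le fun φ hφ => ENNReal.ofReal_le_ofReal ?_
    rw [hφ.setIntegral_eq]
    exact hK φ hφ

namespace HasQuarterVariation

variable {f : ℝ → ℝ} {a b : ℝ}

lemma superadditive (h : HasQuarterVariation f a b) {c e d : ℝ} (hc : a ≤ c) (hce : c < e)
    (hed : e < d) (hd : d ≤ b) : meanOsc f c e + meanOsc f e d ≤ meanOsc f c d := by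
  have h1 : ∀ φ, IsUnitTestFunction (Ioo c e) φ → ∀ ψ, IsUnitTestFunction (Ioo e d) ψ →
      (∫ x, f x * deriv φ x) + ∫ x, f x * deriv ψ x ≤ 4 * meanOsc f c d := by
    intro φ hφ ψ hψ
    have hdis : Disjoint (Ioo c e) (Ioo e d) :=
      disjoint_left.2 fun x hx hx' => lt_asymm hx.2 hx'.1
    have := h.integral_le hc (hce.trans hed) hd ((hφ.add hψ hdis).mono
      (union_subset (Ioo_subset_Ioo_right hed.le) (Ioo_subset_Ioo_left hce.le)))
    rw [← integral_add (hφ.integrable_mul_deriv h.integrable)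
      (hψ.integrable_mul_deriv h.integrable)]
    convert this using 3 with x
    rw [deriv_fun_add (hφ.differentiable x) (hψ.differentiable x)]
    ring
  have h2 : ∀ φ, IsUnitTestFunction (Ioo c e) φ →
      4 * meanOsc f e d ≤ 4 * meanOsc f c d - ∫ x, f x * deriv φ x := fun φ hφ =>
    h.le_of_forall (hc.trans hce.le) hed hd fun ψ hψ => by linarith [h1 φ hφ ψ hψ]
  have h3 : 4 * meanOsc f c e ≤ 4 * meanOsc f c d - 4 * meanOsc f e d :=
    h.le_of_forall hc hce (hed.le.trans hd) fun φ hφ => by linarith [h2 φ hφ]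
  linarith

/-- Subadditivity for overlapping intervals, by a partition of unity: the product rule costs
nothing, since the products with the cut-off functions are again test functions bounded by one. -/
lemma subadditive_overlap (h : HasQuarterVariation f a b) {c u v d : ℝ} (hc : a ≤ c) (hcu : c < u)
    (huv : u < v) (hvd : v < d) (hd : d ≤ b) :
    meanOsc f c d ≤ meanOsc f c v + meanOsc f u d := by
  obtain ⟨u', huu', hu'v⟩ := exists_between huv
  obtain ⟨v', hu'v', hv'v⟩ := exists_between hu'v
  have hpos : 0 < v' - u' := sub_pos.2 hu'v'
  set χ : ℝ → ℝ := fun x => Real.smoothTransition ((v' - x) / (v' - u')) with hχ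
  have hχc : ContDiff ℝ ∞ χ :=
    Real.smoothTransition.contDiff.comp ((contDiff_const.sub contDiff_id).div_const _)
  have hχ0 : ∀ x, 0 ≤ χ x := fun x => Real.smoothTransition.nonneg _
  have hχ1 : ∀ x, χ x ≤ 1 := fun x => Real.smoothTransition.le_one _
  have hs1 : tsupport χ ⊆ Iic v' := closure_minimal (fun x hx => by
    by_contra hx'
    refine hx (Real.smoothTransition.zero_of_nonpos (div_nonpos_of_nonpos_of_nonneg ?_ hpos.le))
    linarith [not_le.1 (mt mem_Iic.2 hx')]) isClosed_Iic
  have hs2 : tsupport (fun x => 1 - χ x) ⊆ Ici u' := closure_minimal (fun x hx => by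
    by_contra hx'
    refine hx (sub_eq_zero.2 (Real.smoothTransition.one_of_one_le ?_).symm)
    rw [one_le_div hpos]
    linarith [not_le.1 (mt mem_Ici.2 hx')]) isClosed_Ici
  have key : 4 * meanOsc f c d ≤ 4 * meanOsc f c v + 4 * meanOsc f u d := by
    refine h.le_of_forall hc (by linarith) hd fun φ hφ => ?_
    have t1 : IsUnitTestFunction (Ioo c v) fun x => φ x * χ x :=
      hφ.mul hχc (fun x => abs_le.2 ⟨by linarith [hχ0 x], hχ1 x⟩) fun x hx =>
        ⟨(hφ.tsupport_subset hx.1).1, lt_of_le_of_lt (hs1 hx.2) hv'v⟩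
    have t2 : IsUnitTestFunction (Ioo u d) fun x => φ x * (1 - χ x) :=
      hφ.mul (contDiff_const.sub hχc)
        (fun x => abs_le.2 ⟨by linarith [hχ1 x], by linarith [hχ0 x]⟩) fun x hx =>
        ⟨lt_of_lt_of_le huu' (hs2 hx.2), (hφ.tsupport_subset hx.1).2⟩
    have e1 := h.integral_le hc (by linarith) (by linarith) t1
    have e2 := h.integral_le (by linarith) (by linarith) hd t2
    have e3 : ∫ x, f x * deriv φ x = (∫ x, f x * deriv (fun x => φ x * χ x) x) +
        ∫ x, f x * deriv (fun x => φ x * (1 - χ x)) x := by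
      rw [← integral_add (t1.integrable_mul_deriv h.integrable)
        (t2.integrable_mul_deriv h.integrable)]
      congr 1 with x
      rw [← mul_add, ← deriv_fun_add (t1.differentiable x) (t2.differentiable x)]
      congr 2 with y
      ring
    linarith
  linarith

lemma intervalIntegrable (h : HasQuarterVariation f a b) (x y : ℝ) :
    IntervalIntegrable f volume x y := h.integrable.intervalIntegrable

/-- Additivity on adjacent intervals: in the overlapping inequality the overlap may be shrunk to a
point, because the mean oscillation is continuous in the end points. -/
lemma additive (h : HasQuarterVariation f a b) {c e d : ℝ} (hc : a ≤ c) (hce : c < e)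
    (hed : e < d) (hd : d ≤ b) : meanOsc f c d = meanOsc f c e + meanOsc f e d := by
  refine le_antisymm ?_ (h.superadditive hc hce hed hd)
  have h1 : ∀ u ∈ Ioo c e, meanOsc f c d ≤ meanOsc f c e + meanOsc f u d := by
    intro u hu
    have hlim : Tendsto (fun v => meanOsc f c v + meanOsc f u d) (𝓝[>] e)
        (𝓝 (meanOsc f c e + meanOsc f u d)) :=
      ((continuousAt_meanOsc h.intervalIntegrable hce.ne).tendsto.mono_left
        nhdsWithin_le_nhds).add_const _
    refine ge_of_tendsto hlim ?_
    filter_upwards [Ioo_mem_nhdsGT hed] with v hv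
    exact h.subadditive_overlap hc hu.1 (hu.2.trans hv.1) hv.2 hd
  have hlim : Tendsto (fun u => meanOsc f c e + meanOsc f u d) (𝓝[<] e)
      (𝓝 (meanOsc f c e + meanOsc f e d)) := by
    simp_rw [meanOsc_symm f _ d]
    exact ((continuousAt_meanOsc h.intervalIntegrable hed.ne').tendsto.mono_left
      nhdsWithin_le_nhds).const_add _
  refine ge_of_tendsto hlim ?_
  filter_upwards [Ioo_mem_nhdsLT hce] with u hu
  exact h1 u hu

end HasQuarterVariation

/-! ### The continuous representative -/

/-- The difference of two mollified values of `f` is the integral of `f` against the derivative of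
a test function with values in `[0, 1]`, a difference of two translates of a primitive of the
mollifier. -/
lemma exists_testFunction_convolution_sub (ρ : ContDiffBump (0 : ℝ)) {f : ℝ → ℝ}
    (hf : Integrable f) {c d x y : ℝ} (hcx : c < x - ρ.rOut) (hxy : x ≤ y)
    (hyd : y + ρ.rOut < d) :
    ∃ φ, IsUnitTestFunction (Ioo c d) φ ∧ ∫ z, f z * deriv φ z =
      convolution (ρ.normed volume) f (ContinuousLinearMap.lsmul ℝ ℝ) volume x -
      convolution (ρ.normed volume) f (ContinuousLinearMap.lsmul ℝ ℝ) volume y := by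
  set k : ℝ → ℝ := ρ.normed volume with hk
  set r := ρ.rOut
  have hr0 : 0 < r := ρ.rOut_pos
  have hkc : ContDiff ℝ ∞ k := ρ.contDiff_normed
  have hk0 : ∀ s, 0 ≤ k s := fun s => ρ.nonneg_normed s
  have hks : Function.support k = Ioo (-r) r := by
    rw [hk, ρ.support_normed_eq, Real.ball_eq_Ioo, zero_sub, zero_add]
  set R : ℝ → ℝ := fun u => ∫ s in (-r)..u, k s with hR
  have hRd : ∀ u, HasDerivAt R (k u) u := fun u => hkc.continuous.integral_hasStrictDerivAt _ u
    |>.hasDerivAt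
  have hRc : ContDiff ℝ ∞ R := by
    rw [contDiff_infty_iff_deriv]
    refine ⟨fun u => (hRd u).differentiableAt, ?_⟩
    rwa [show deriv R = k from funext fun u => (hRd u).deriv]
  have hRmono : Monotone R := monotone_of_deriv_nonneg (fun u => (hRd u).differentiableAt)
    fun u => by rw [(hRd u).deriv]; exact hk0 u
  have hR0 : ∀ u ≤ -r, R u = 0 := fun u hu => by
    simp only [hR]
    rw [intervalIntegral.integral_congr (g := fun _ => (0 : ℝ)) fun s hs => ?_]
    · simp
    · rw [uIcc_of_ge hu] at hs
      have : s ∉ Function.support k := by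
        rw [hks]
        exact fun h => absurd h.1 (not_lt.2 hs.2)
      simpa using this
  have hR1 : ∀ u, r ≤ u → R u = 1 := fun u hu => by
    simp only [hR]
    rw [intervalIntegral.integral_eq_integral_of_support_subset, hk, ρ.integral_normed]
    rw [hks]
    exact fun s hs => ⟨hs.1, (hs.2.trans_le hu).le⟩
  have hRnn : ∀ u, 0 ≤ R u := fun u => by
    rw [← hR0 (min u (-r)) (min_le_right _ _)]
    exact hRmono (min_le_left _ _)
  have hRle : ∀ u, R u ≤ 1 := fun u => by
    rw [← hR1 (max u r) (le_max_right _ _)]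
    exact hRmono (le_max_left _ _)
  set φ : ℝ → ℝ := fun z => R (z - x) - R (z - y) with hφ
  have hsupp : tsupport φ ⊆ Icc (x - r) (y + r) := by
    refine closure_minimal (fun z hz => ?_) isClosed_Icc
    by_contra hz'
    refine hz ?_
    simp only [hφ]
    rcases not_and_or.1 hz' with h | h
    · rw [hR0 _ (by linarith [not_le.1 h]), hR0 _ (by linarith [not_le.1 h]), sub_zero]
    · rw [hR1 _ (by linarith [not_le.1 h]), hR1 _ (by linarith [not_le.1 h]), sub_self]
  have hφd : ∀ z, HasDerivAt φ (k (z - x) - k (z - y)) z := fun z =>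
    ((hRd (z - x)).comp_sub_const z x).sub ((hRd (z - y)).comp_sub_const z y)
  refine ⟨φ, ⟨?_, ?_, ?_, ?_⟩, ?_⟩
  · exact (hRc.comp (contDiff_id.sub contDiff_const)).sub
      (hRc.comp (contDiff_id.sub contDiff_const))
  · exact isCompact_Icc.of_isClosed_subset (isClosed_tsupport φ) hsupp
  · exact hsupp.trans fun z hz => ⟨hcx.trans_le hz.1, hz.2.trans_lt hyd⟩
  · intro z
    have h1 : R (z - y) ≤ R (z - x) := hRmono (by linarith)
    rw [abs_of_nonneg (sub_nonneg.2 h1)]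
    linarith [hRle (z - x), hRnn (z - y)]
  · have hconv : ∀ u, convolution k f (ContinuousLinearMap.lsmul ℝ ℝ) volume u =
        ∫ z, f z * k (z - u) := by
      intro u
      rw [convolution_eq_swap]
      congr 1 with z
      rw [ContinuousLinearMap.lsmul_apply, smul_eq_mul, mul_comm, hk, ← ρ.normed_neg, neg_sub]
    have hint : ∀ u, Integrable fun z => f z * k (z - u) := by
      intro u
      refine hf.locallyIntegrable.integrable_smul_right_of_hasCompactSupport
        (hkc.continuous.comp (continuous_id.sub continuous_const)) ?_
      exact ρ.hasCompactSupport_normed.comp_homeomorph (Homeomorph.subRight u)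
    rw [hconv, hconv, ← integral_sub (hint x) (hint y)]
    congr 1 with z
    rw [(hφd z).deriv]
    ring

lemma exists_bump_seq : ∃ ρ : ℕ → ContDiffBump (0 : ℝ),
    Tendsto (fun n => (ρ n).rOut) atTop (𝓝 0) ∧ ∀ n, (ρ n).rOut ≤ 2 * (ρ n).rIn := by
  refine ⟨fun n => ⟨1 / ((n : ℝ) + 1) / 2, 1 / ((n : ℝ) + 1), by positivity, ?_⟩, ?_, ?_⟩
  · exact half_lt_self (by positivity)
  · exact tendsto_one_div_add_atTop_nhds_zero_nat
  · intro n
    simp only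
    linarith

namespace HasQuarterVariation

variable {f : ℝ → ℝ} {a b : ℝ}

/-- Off a null set the increments of `f` are bounded by the total variation. -/
lemma exists_ae_abs_sub_le (h : HasQuarterVariation f a b) : ∃ E : Set ℝ, (∀ᵐ x, x ∈ E) ∧
    ∀ x ∈ E, ∀ y ∈ E, ∀ c d, a ≤ c → c < x → x ≤ y → y < d → d ≤ b →
      |f y - f x| ≤ 4 * meanOsc f c d := by
  obtain ⟨ρ, hρ, hρ2⟩ := exists_bump_seq
  refine ⟨_, ContDiffBump.ae_convolution_tendsto_right_of_locallyIntegrable hρ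
    (Eventually.of_forall hρ2) h.integrable.locallyIntegrable (μ := volume), ?_⟩
  intro x hx y hy c d hc hcx hxy hyd hd
  refine le_of_tendsto (((show Tendsto _ _ _ from hy).sub (show Tendsto _ _ _ from hx)).abs) ?_
  filter_upwards [hρ.eventually_lt_const (sub_pos.2 hcx), hρ.eventually_lt_const (sub_pos.2 hyd)]
    with n h1 h2
  obtain ⟨φ, hφ, hφi⟩ := exists_testFunction_convolution_sub (ρ n) h.integrable
    (c := c) (d := d) (by linarith) hxy (by linarith)
  have hcd : c < d := by linarith
  have e1 := h.integral_le hc hcd hd hφ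
  have e2 := h.integral_le hc hcd hd hφ.neg
  have e3 : ∫ z, f z * deriv (fun t => -φ t) z = -∫ z, f z * deriv φ z := by
    rw [← integral_neg]
    congr 1 with z
    rw [deriv.fun_neg, mul_neg]
  rw [e3] at e2
  rw [hφi] at e1 e2
  exact abs_le.2 ⟨by linarith, by linarith⟩

/-- With `w x` the mean oscillation over `(a, x)`, the function `f` factors almost everywhere as a
Lipschitz function of the continuous function `w`. -/
lemma exists_continuous_representative (h : HasQuarterVariation f a b) : ∃ g : ℝ → ℝ,
    ContinuousOn g (Ioo a b) ∧ (∀ᵐ x, x ∈ Ioo a b → f x = g x) ∧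
    ∀ x y, a < x → x < y → y < b → |g y - g x| ≤ 4 * meanOsc f x y := by
  obtain ⟨E, hE, hEf⟩ := h.exists_ae_abs_sub_le
  set w : ℝ → ℝ := meanOsc f a with hw
  have hwc : ContinuousOn w (Ioo a b) := fun x hx =>
    (continuousAt_meanOsc h.intervalIntegrable hx.1.ne).continuousWithinAt
  have hwadd : ∀ x y, a < x → x < y → y ≤ b → meanOsc f x y = w y - w x :=
    fun x y hx hxy hy => by
      rw [hw, h.additive le_rfl hx hxy hy]
      ring
  have hwmono : ∀ x y, a < x → x < y → y ≤ b → w x ≤ w y := fun x y hx hxy hy => by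
    linarith [hwadd x y hx hxy hy, meanOsc_nonneg (f := f) hxy.le]
  have hlt : ∀ x ∈ E ∩ Ioo a b, ∀ y ∈ E ∩ Ioo a b, x < y → |f y - f x| ≤ 4 * (w y - w x) := by
    intro x hx y hy hxy
    have h1 : ∀ c ∈ Ioo a x, |f y - f x| ≤ 4 * (w y - w c) := by
      intro c hc
      have hlim : Tendsto (fun d => 4 * (w d - w c)) (𝓝[>] y) (𝓝 (4 * (w y - w c))) :=
        (((hwc.continuousAt (isOpen_Ioo.mem_nhds hy.2)).tendsto.mono_left
          nhdsWithin_le_nhds).sub_const _).const_mul 4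
      refine ge_of_tendsto hlim ?_
      filter_upwards [Ioo_mem_nhdsGT hy.2.2] with d hd
      rw [← hwadd c d hc.1 (by linarith [hc.2, hd.1]) hd.2.le]
      exact hEf x hx.1 y hy.1 c d hc.1.le hc.2 hxy.le hd.1 hd.2.le
    have hlim : Tendsto (fun c => 4 * (w y - w c)) (𝓝[<] x) (𝓝 (4 * (w y - w x))) :=
      (((hwc.continuousAt (isOpen_Ioo.mem_nhds hx.2)).tendsto.mono_left
        nhdsWithin_le_nhds).const_sub _).const_mul 4
    refine ge_of_tendsto hlim ?_
    filter_upwards [Ioo_mem_nhdsLT hx.2.1] with c hc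
    exact h1 c hc
  have hle : ∀ x ∈ E ∩ Ioo a b, ∀ y ∈ E ∩ Ioo a b, |f x - f y| ≤ 4 * |w x - w y| := by
    intro x hx y hy
    rcases lt_trichotomy x y with hxy | rfl | hxy
    · rw [abs_sub_comm, abs_sub_comm (w x),
        abs_of_nonneg (sub_nonneg.2 (hwmono x y hx.2.1 hxy hy.2.2.le))]
      exact hlt x hx y hy hxy
    · simp
    · rw [abs_of_nonneg (sub_nonneg.2 (hwmono y x hy.2.1 hxy hx.2.2.le))]
      exact hlt y hy x hx hxy
  set p : ℝ → ℝ := Function.invFunOn w (E ∩ Ioo a b)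
  have hpm : ∀ s ∈ w '' (E ∩ Ioo a b), p s ∈ E ∩ Ioo a b ∧ w (p s) = s := fun s hs =>
    ⟨Function.invFunOn_mem hs, Function.invFunOn_eq hs⟩
  have hLip : LipschitzOnWith 4 (f ∘ p) (w '' (E ∩ Ioo a b)) := by
    refine LipschitzOnWith.of_dist_le_mul fun s hs t ht => ?_
    obtain ⟨hs1, hs2⟩ := hpm s hs
    obtain ⟨ht1, ht2⟩ := hpm t ht
    have := hle _ hs1 _ ht1
    rw [hs2, ht2] at this
    simpa [Real.dist_eq] using this
  obtain ⟨F, hF, hFeq⟩ := hLip.extend_real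
  refine ⟨F ∘ w, hF.continuous.comp_continuousOn hwc, ?_, fun x y hx hxy hy => ?_⟩
  · filter_upwards [hE] with x hxE hxI
    have hx : w x ∈ w '' (E ∩ Ioo a b) := ⟨x, ⟨hxE, hxI⟩, rfl⟩
    obtain ⟨h1, h2⟩ := hpm _ hx
    rw [Function.comp_apply, ← hFeq hx, Function.comp_apply]
    have := hle x ⟨hxE, hxI⟩ _ h1
    rw [h2, sub_self, abs_zero, mul_zero] at this
    exact sub_eq_zero.1 (abs_nonpos_iff.1 this)
  · have := hF.dist_le_mul (w y) (w x)
    rw [Real.dist_eq, Real.dist_eq, ← hwadd x y hx hxy hy.le,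
      abs_of_nonneg (meanOsc_nonneg hxy.le)] at this
    simpa using this

end HasQuarterVariation

/-- The total variation of a monotone Lipschitz function is at most its increment. -/
lemma integral_mul_deriv_le_of_monotoneOn {g φ : ℝ → ℝ} {x y : ℝ} {K : NNReal} (hxy : x < y)
    (hg : LipschitzOnWith K g (Icc x y)) (hm : MonotoneOn g (Icc x y))
    (hφ : IsUnitTestFunction (Ioo x y) φ) : ∫ t in x..y, g t * deriv φ t ≤ g y - g x := by
  have hu : uIcc x y = Icc x y := uIcc_of_le hxy.le
  have hgac : AbsolutelyContinuousOnInterval g x y :=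
    LipschitzOnWith.absolutelyContinuousOnInterval (by rwa [hu])
  have hφac : AbsolutelyContinuousOnInterval φ x y :=
    ContDiffOn.absolutelyContinuousOnInterval (hφ.contDiff.of_le (by simp)).contDiffOn
  have hz : ∀ t, t ∉ Ioo x y → φ t = 0 := fun t ht =>
    image_eq_zero_of_notMem_tsupport fun h => ht (hφ.tsupport_subset h)
  rw [hgac.integral_mul_deriv_eq_deriv_mul hφac, hz x (by simp), hz y (by simp),
    ← hgac.integral_deriv_eq_sub, mul_zero, mul_zero, sub_zero, zero_sub,
    ← intervalIntegral.integral_neg]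
  have hgi := hgac.intervalIntegrable_deriv
  have hφi : IntervalIntegrable (fun t => -(deriv g t * φ t)) volume x y :=
    (hgi.mul_continuousOn hφ.contDiff.continuous.continuousOn).neg
  refine intervalIntegral.integral_mono_on_of_le_Ioo hxy.le hφi hgi fun t ht => ?_
  have hd : 0 ≤ deriv g t := by
    rw [← derivWithin_of_mem_nhds (Icc_mem_nhds ht.1 ht.2)]
    exact hm.derivWithin_nonneg
  nlinarith [(abs_le.1 (hφ.abs_le_one t)).1]

lemma HasQuarterVariation.exists_hasQuarterOsc {f : ℝ → ℝ} {a b : ℝ}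
    (h : HasQuarterVariation f a b) :
    ∃ g, HasQuarterOsc g a b ∧ ∀ᵐ x, x ∈ Ioo a b → f x = g x := by
  obtain ⟨g, hgc, hfg, hlow⟩ := h.exists_continuous_representative
  have hsub : ∀ x y, a < x → y < b → ∀ᵐ t, t ∈ Ioo x y → f t = g t := fun x y hx hy => by
    filter_upwards [hfg] with t ht htI
    exact ht ⟨hx.trans htI.1, htI.2.trans hy⟩
  have hW : ∀ x y, a < x → x < y → y < b → meanOsc g x y = meanOsc f x y :=
    fun x y hx hxy hy => (meanOsc_congr hxy.le (hsub x y hx hy)).symm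
  refine ⟨g, ⟨hgc, fun x y z hx hxy hyz hz => ?_, fun x y hx hxy hy => ?_,
    fun x y K hx hxy hy hK hm => ?_⟩, hfg⟩
  · rw [hW x z hx (hxy.trans hyz) hz, hW x y hx hxy (hyz.trans hz), hW y z (hx.trans hxy) hyz hz]
    exact h.additive hx.le hxy hyz hz.le
  · rw [hW x y hx hxy hy]
    exact hlow x y hx hxy hy
  · rw [hW x y hx hxy hy]
    refine h.le_of_forall hx.le hxy hy.le fun φ hφ => ?_
    have e1 : ∫ t, f t * deriv φ t = ∫ t in x..y, g t * deriv φ t := by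
      rw [← hφ.setIntegral_eq, intervalIntegral.integral_of_le hxy.le,
        integral_Ioc_eq_integral_Ioo]
      refine setIntegral_congr_ae measurableSet_Ioo ?_
      filter_upwards [hsub x y hx hy] with t ht htI
      rw [ht htI]
    rw [e1]
    rcases hm with hm | hm
    · exact (integral_mul_deriv_le_of_monotoneOn hxy hK hm hφ).trans (le_abs_self _)
    · have hK' : LipschitzOnWith K (fun t => -g t) (Icc x y) :=
        fun u hu v hv => by simpa using hK hu hv
      have := integral_mul_deriv_le_of_monotoneOn hxy hK' hm.neg hφ.neg
      refine le_trans (le_of_eq ?_) (this.trans ?_)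
      · congr 1 with t
        rw [deriv.fun_neg, neg_mul_neg]
      · rw [← abs_neg]
        exact (le_of_eq (by ring)).trans (le_abs_self _)

lemma HasQuarterVariation.ae_affine {f : ℝ → ℝ} {a b : ℝ} (h : HasQuarterVariation f a b) :
    ∃ α β : ℝ, ∀ᵐ x, x ∈ Ioo a b → f x = α * x + β := by
  obtain ⟨g, hg, hfg⟩ := h.exists_hasQuarterOsc
  obtain ⟨α, β, hαβ⟩ := hg.affine
  refine ⟨α, β, ?_⟩
  filter_upwards [hfg] with x hx hxI
  rw [hx hxI, hαβ x hxI]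

/-! ### Exhaustion by compact intervals -/

/-- A function that is affine almost everywhere on each compactly contained interval is affine
almost everywhere. -/
lemma ae_affine_of_forall_compact {f : ℝ → ℝ} {a b : ℝ} (hab : a < b)
    (h : ∀ c d, a < c → c < d → d < b →
      ∃ α β : ℝ, ∀ᵐ x, x ∈ Ioo c d → f x = α * x + β) :
    ∃ α β : ℝ, ∀ᵐ x, x ∈ Ioo a b → f x = α * x + β := by
  obtain ⟨m, ham, hmb⟩ := exists_between hab
  set c : ℕ → ℝ := fun n => a + (m - a) / 2 * (1 / ((n : ℝ) + 1)) with hc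
  set d : ℕ → ℝ := fun n => b - (b - m) / 2 * (1 / ((n : ℝ) + 1)) with hd
  have hn : ∀ n : ℕ, 0 < 1 / ((n : ℝ) + 1) ∧ 1 / ((n : ℝ) + 1) ≤ 1 := fun n => by
    refine ⟨by positivity, ?_⟩
    rw [div_le_one (by positivity)]
    linarith [Nat.cast_nonneg (α := ℝ) n]
  have hac : ∀ n, a < c n := fun n => by
    have := mul_pos (half_pos (sub_pos.2 ham)) (hn n).1
    simp only [hc]
    linarith
  have hdb : ∀ n, d n < b := fun n => by
    have := mul_pos (half_pos (sub_pos.2 hmb)) (hn n).1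
    simp only [hd]
    linarith
  have hc0 : ∀ n, c n ≤ c 0 := fun n => by
    have := mul_le_mul_of_nonneg_left (hn n).2 (half_pos (sub_pos.2 ham)).le
    simp only [hc]
    norm_num at this ⊢
    linarith
  have hd0 : ∀ n, d 0 ≤ d n := fun n => by
    have := mul_le_mul_of_nonneg_left (hn n).2 (half_pos (sub_pos.2 hmb)).le
    simp only [hd]
    norm_num at this ⊢
    linarith
  have hcd0 : c 0 < d 0 := by
    simp only [hc, hd]
    norm_num
    linarith
  have hex : ∀ n, ∃ α β : ℝ, ∀ᵐ x, x ∈ Ioo (c n) (d n) → f x = α * x + β := fun n =>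
    h _ _ (hac n) ((hc0 n).trans_lt (hcd0.trans_le (hd0 n))) (hdb n)
  choose α β hαβ using hex
  have heq : ∀ n, α n = α 0 ∧ β n = β 0 := by
    intro n
    have hae : (fun x => α n * x + β n) =ᵐ[volume.restrict (Ioo (c 0) (d 0))]
        fun x => α 0 * x + β 0 := by
      refine (ae_restrict_iff' measurableSet_Ioo).2 ?_
      filter_upwards [hαβ n, hαβ 0] with x h1 h2 hx
      rw [← h1 ⟨(hc0 n).trans_lt hx.1, hx.2.trans_le (hd0 n)⟩, ← h2 hx]
    have hon := Measure.eqOn_open_of_ae_eq hae isOpen_Ioo (by fun_prop) (by fun_prop)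
    obtain ⟨s, hs1, hs2⟩ := exists_between hcd0
    obtain ⟨t, ht1, ht2⟩ := exists_between hs2
    have e1 : α n * s + β n = α 0 * s + β 0 := hon ⟨hs1, hs2⟩
    have e2 : α n * t + β n = α 0 * t + β 0 := hon ⟨hs1.trans ht1, ht2⟩
    have e3 : (α n - α 0) * (t - s) = 0 := by linear_combination e2 - e1
    have e4 : α n = α 0 :=
      sub_eq_zero.1 ((mul_eq_zero.1 e3).resolve_right (sub_pos.2 ht1).ne')
    refine ⟨e4, ?_⟩
    rw [e4] at e1
    linarith
  refine ⟨α 0, β 0, ?_⟩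
  filter_upwards [ae_all_iff.2 hαβ] with x hx hxI
  have hlim := tendsto_one_div_add_atTop_nhds_zero_nat (𝕜 := ℝ)
  have hcl : Tendsto c atTop (𝓝 a) := by
    simpa [hc] using (hlim.const_mul ((m - a) / 2)).const_add a
  have hdl : Tendsto d atTop (𝓝 b) := by
    simpa [hd] using (hlim.const_mul ((b - m) / 2)).const_sub b
  obtain ⟨n, h1, h2⟩ :=
    ((hcl.eventually_lt_const hxI.1).and (hdl.eventually_const_lt hxI.2)).exists
  rw [hx n ⟨h1, h2⟩, (heq n).1, (heq n).2]

theorem theorem1 (a b : ℝ) (hab : a < b) (f : ℝ → ℝ)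
    (hf : MeasureTheory.LocallyIntegrableOn f (Set.Ioo a b) MeasureTheory.volume)
    (hosc : ∀ c d : ℝ, a < c → c < d → d < b →
      ENNReal.ofReal (osc f (Set.Ioo c d)) = 1 / 4 * totalVariation f (Set.Ioo c d)) :
    ∃ α β : ℝ, ∀ᵐ x ∂(MeasureTheory.volume.restrict (Set.Ioo a b)), f x = α * x + β := by
  simp_rw [ae_restrict_iff' measurableSet_Ioo]
  refine ae_affine_of_forall_compact hab fun c d hc hcd hd => ?_
  set f₁ : ℝ → ℝ := (Icc c d).indicator f with hf₁
  have hint : Integrable f₁ := by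
    rw [hf₁, integrable_indicator_iff measurableSet_Icc]
    exact hf.integrableOn_compact_subset
      (fun x hx => ⟨hc.trans_le hx.1, hx.2.trans_lt hd⟩) isCompact_Icc
  have heq : ∀ x ∈ Icc c d, f₁ x = f x := fun x hx => indicator_of_mem hx f
  have h : HasQuarterVariation f₁ c d := by
    refine HasQuarterVariation.of_osc_eq hint fun u v hu huv hv => ?_
    have hon : ∀ x ∈ Ioo u v, f₁ x = f x := fun x hx =>
      heq x ⟨hu.trans hx.1.le, hx.2.le.trans hv⟩
    have e1 : osc f₁ (Ioo u v) = osc f (Ioo u v) := by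
      rw [osc_Ioo_eq_meanOsc _ huv, osc_Ioo_eq_meanOsc _ huv]
      exact meanOsc_congr huv.le (Eventually.of_forall hon)
    have e2 : totalVariation f₁ (Ioo u v) = totalVariation f (Ioo u v) := by
      unfold totalVariation
      refine iSup_congr fun φ => iSup_congr fun _ => ?_
      congr 1
      exact setIntegral_congr_fun measurableSet_Ioo fun x hx => by simp only [hon x hx]
    rw [e1, e2]
    exact hosc u v (hc.trans_le hu) huv (hv.trans_lt hd)
  obtain ⟨α, β, hαβ⟩ := h.ae_affine
  refine ⟨α, β, ?_⟩
  filter_upwards [hαβ] with x hx hxI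
  rw [← heq x (Ioo_subset_Icc_self hxI), hx hxI]
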